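/- **Theorem.** Let $p\equiv 1\pmod 4$ be a prime with $\left(\frac{-11}{p}\right)=1$. Suppose $p=c^2+d^2$ and $4p=x^2+11y^2$ with $c,d,x,y\in\mathbb Z$, $c\equiv 1\pmod 4$, $d=2^rd_0$ with $d_0$ odd, and $y=2^ty_0$ with $y_0\equiv 1\pmod 4$ (where $r,t\ge 0$ and $d_0,y_0$ are integers). Write $(m,n)$ for the greatest common divisor, and assume that $(c,x+2d)=1$ or $(d_0,x+2c)=1$. Here $[\cdot]$ is the greatest integer function, and fractions in congruences mod $p$ are read in $\mathbb Z/p\mathbb Z$. In each case below either all upper or all lower signs are taken; thus "$x\equiv\pm 4c,\pm 9c$" with upper signs means $x\equiv 4c$ or $x\equiv 9c$, and with lower signs $x\equiv -4c$ or $x\equiv -9c$. Then $p\nmid cx$; at least one of $x\equiv\pm4c,\pm9c\pmod{11}$ or $x\equiv\pm4d,\pm9d\pmod{11}$ holds; and $8\mid y$ if $p\equiv1\pmod 8$ and $2\mid x$. Moreover: (i) If $p\equiv 1\pmod 8$, then $$(-11)^{[p/8]}\equiv\begin{cases} \pm(-1)^{[x/4]}\pmod p&\text{if } 2\nmid x \text{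 and } x\equiv\pm4c,\pm9c\pmod{11},\\ \pm(-1)^{[x/4]}\frac dc\pmod p&\text{if } 2\nmid x \text{ and } x\equiv\pm4d,\pm9d\pmod{11},\\ \mp(-1)^{[x/8]+\frac y8}\pmod p&\text{if } 2\mid x \text{ and } x\equiv\pm4c,\pm9c\pmod{11},\\ \mp(-1)^{[x/8]+\frac y8}\frac dc\pmod p&\text{if } 2\mid x \text{ and } x\equiv\pm4d,\pm9d\pmod{11}. \end{cases}$$ (ii) If $p\equiv 5\pmod 8$, then $$(-11)^{[p/8]}\equiv\begin{cases} \mp(-1)^{\frac{x^2-1}8}\frac yx\pmod p&\text{if } 2\nmid x \text{ and } x\equiv\pm4c,\pm9c\pmod{11},\\ \mp(-1)^{\frac{x^2-1}8}\frac{dy}{cx}\pmod p&\text{if } 2\nmid x \text{ and } x\equiv\pm4d,\pm9d\pmod{11},\\ \mp(-1)^{\frac{p-5}8}\frac yx\pmod p&\text{if } 2\mid x \text{ and } x\equiv\pm4c,\pm9c\pmod{11},\\ \mp(-1)^{\frac{p-5}8}\frac{dy}{cx}\pmod p&\text{if } 2\mid x \text{ and } x\equiv\pm4d,\pm9d\pmod{11}.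 \end{cases}$$ -/

import Mathlib

/-!
Modulo the Gaussian prime `π = c + di`, where `i` becomes `-c/d = d/c`, the power
`z ^ ((p - 1) / 4)` is the quartic residue symbol `(z/π)₄`, a fourth root of unity. As
`(x/y)² ≡ -11 (mod p)`, the power `(-11) ^ [p/8]` is read off from `(x/π)₄` and `(y/π)₄`, up to a
factor `y/x` when `p ≡ 5 (mod 8)`. Put `ρ = 2π`, so that `x² - N(ρ) = -11y²`. The Gaussian integer
`x + ρ` has norm `2nx + 11y²` with `n = x + 2c`, so modulo it `2nx ≡ -11y²`; quartic reciprocity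
flips the symbols of `n`, `x`, `11` and `y` over `x + ρ` and expresses `(x/π)₄ / (y/π)₄`
through the symbol `((x + ρ)/11)₄`, whose value depends on the residues of `x`, `c`, `d` modulo `11`
only. For even `x` the same is done with `x/2`, `y/2` and an associate of `π` in place of `ρ`.
-/

open UniqueFactorizationMonoid

local notation "ℤ[i]" => GaussianInt

/-- The Gaussian unit `i`. -/
def gaussI : ℤ[i] := ⟨0, 1⟩

theorem gaussI_sq : gaussI ^ 2 = -1 := by
  rw [gaussI, pow_two]; ext <;> simp

theorem gaussI_pow_four : gaussI ^ 4 = 1 := by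
  linear_combination (gaussI ^ 2 - 1) * gaussI_sq

theorem star_gaussI : star gaussI = -gaussI := by
  rw [gaussI]; ext <;> simp

theorem gaussInt_eq_re_add_im_mul (b : ℤ[i]) : b = (b.re : ℤ[i]) + (b.im : ℤ[i]) * gaussI := by
  rw [gaussI]; ext <;> simp

theorem gaussInt_norm_eq (b : ℤ[i]) : b.norm = b.re ^ 2 + b.im ^ 2 := by
  rw [Zsqrtd.norm_def]; ring

theorem norm_eq_of_associated {a b : ℤ[i]} (h : Associated a b) : a.norm = b.norm :=
  Zsqrtd.norm_eq_of_associated (by norm_num) h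

theorem odd_norm_intCast {n : ℤ} (h : Odd n) : Odd (n : ℤ[i]).norm := by
  rw [Zsqrtd.norm_intCast]
  exact h.mul h

theorem ne_zero_of_odd_norm {a : ℤ[i]} (h : Odd a.norm) : a ≠ 0 := by
  rintro rfl; simp at h

theorem sq_emod_four (a : ℤ) : a ^ 2 % 4 = 0 ∨ a ^ 2 % 4 = 1 := by
  rcases Int.even_or_odd a with h | h
  · obtain ⟨b, rfl⟩ := h
    exact Or.inl (by ring_nf; omega)
  · exact Or.inr (Int.sq_mod_four_eq_one_of_odd h)

theorem norm_emod_four_of_odd {a : ℤ[i]} (ho : Odd a.norm) : a.norm % 4 = 1 := by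
  rw [gaussInt_norm_eq] at ho ⊢
  have ho' := Int.odd_iff.1 ho
  rcases sq_emod_four a.re with h | h <;> rcases sq_emod_four a.im with h' | h' <;> omega

theorem prime_of_norm_prime {l : ℤ[i]} {q : ℕ} (hq : q.Prime) (h : l.norm = q) : Prime l := by
  have hqi : Irreducible (q : ℤ) := (Nat.prime_iff_prime_int.1 hq).irreducible
  rw [← irreducible_iff_prime]
  refine ⟨fun hu => hqi.not_isUnit ?_, fun a b hab => ?_⟩
  · rwa [Zsqrtd.isUnit_iff_norm_isUnit, h] at hu
  · have hmul : (q : ℤ) = a.norm * b.norm := by rw [← h, hab, Zsqrtd.norm_mul]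
    simpa only [Zsqrtd.isUnit_iff_norm_isUnit] using hqi.isUnit_or_isUnit hmul

theorem exists_prime_norm_eq {q : ℕ} [hq : Fact q.Prime] (h : q % 4 = 1) :
    ∃ l : ℤ[i], Prime l ∧ l.norm = q := by
  obtain ⟨a, b, hab⟩ := Nat.Prime.sq_add_sq (p := q) (by omega)
  have hn : (⟨a, b⟩ : ℤ[i]).norm = q := by
    rw [gaussInt_norm_eq]
    dsimp only
    exact_mod_cast hab
  exact ⟨⟨a, b⟩, prime_of_norm_prime hq.out hn, hn⟩

theorem natCast_eq_mul_star {l : ℤ[i]} {q : ℕ} (hn : l.norm = q) : (q : ℤ[i]) = l * star l := by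
  rw [← Zsqrtd.norm_eq_mul_conj, hn, Int.cast_natCast]

theorem dvd_intCast_iff {l : ℤ[i]} {q : ℕ} (hq : q.Prime) (hn : l.norm = q) (m : ℤ) :
    l ∣ (m : ℤ[i]) ↔ (q : ℤ) ∣ m := by
  constructor
  · rintro ⟨k, hk⟩
    have hnorm := congrArg Zsqrtd.norm hk
    rw [Zsqrtd.norm_intCast, Zsqrtd.norm_mul, hn] at hnorm
    exact ((Nat.prime_iff_prime_int.1 hq).dvd_or_dvd ⟨_, hnorm⟩).elim id id
  · rintro ⟨k, rfl⟩
    rw [Int.cast_mul, Int.cast_natCast, natCast_eq_mul_star hn, mul_assoc]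
    exact dvd_mul_right _ _

theorem star_dvd_star_iff {a b : ℤ[i]} : star a ∣ star b ↔ a ∣ b :=
  map_dvd_iff (starRingAut : RingAut ℤ[i])

theorem prime_star {l : ℤ[i]} (hl : Prime l) : Prime (star l) :=
  (MulEquiv.prime_iff (starRingAut : RingAut ℤ[i])).2 hl

theorem not_dvd_of_isCoprime {l b : ℤ[i]} (hl : Prime l) (h : IsCoprime b l) : ¬ l ∣ b :=
  fun hd => hl.not_isUnit (h.isUnit_of_dvd' hd dvd_rfl)

/-! ### Frobenius on the Gaussian integers -/

theorem dvd_intCast_pow_sub_self (q : ℕ) [Fact q.Prime] (a : ℤ) :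
    (q : ℤ[i]) ∣ (a : ℤ[i]) ^ q - a := by
  have hdvd : (q : ℤ) ∣ a ^ q - a := by
    rw [← ZMod.intCast_zmod_eq_zero_iff_dvd, Int.cast_sub, Int.cast_pow, ZMod.pow_card, sub_self]
  simpa using (Int.castRingHom ℤ[i]).map_dvd hdvd

theorem dvd_pow_prime_sub (q : ℕ) [hq : Fact q.Prime] (b : ℤ[i]) :
    (q : ℤ[i]) ∣ b ^ q - ((b.re : ℤ[i]) + (b.im : ℤ[i]) * gaussI ^ q) := by
  obtain ⟨r, hr⟩ := exists_add_pow_prime_eq hq.out (b.re : ℤ[i]) ((b.im : ℤ[i]) * gaussI)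
  obtain ⟨s, hs⟩ := dvd_intCast_pow_sub_self q b.re
  obtain ⟨t, ht⟩ := dvd_intCast_pow_sub_self q b.im
  rw [← gaussInt_eq_re_add_im_mul] at hr
  exact ⟨s + t * gaussI ^ q + b.re * (b.im * gaussI) * r, by
    rw [hr, mul_pow]; linear_combination hs + gaussI ^ q * ht⟩

theorem dvd_pow_sub_self {q : ℕ} [Fact q.Prime] (h4 : q % 4 = 1) (b : ℤ[i]) :
    (q : ℤ[i]) ∣ b ^ q - b := by
  have hI : gaussI ^ q = gaussI := by
    rw [← Nat.div_add_mod q 4, h4, pow_add, pow_mul, gaussI_pow_four, one_pow, one_mul, pow_one]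
  have h := dvd_pow_prime_sub q b
  rwa [hI, ← gaussInt_eq_re_add_im_mul] at h

theorem dvd_pow_sub_star {q : ℕ} [Fact q.Prime] (h4 : q % 4 = 3) (b : ℤ[i]) :
    (q : ℤ[i]) ∣ b ^ q - star b := by
  have hI : gaussI ^ q = -gaussI := by
    rw [← Nat.div_add_mod q 4, h4, pow_add, pow_mul, gaussI_pow_four]
    linear_combination gaussI * gaussI_sq
  have hstar : star b = b.re + b.im * gaussI ^ q := by
    rw [hI, gaussI]; ext <;> simp
  rw [hstar]
  exact dvd_pow_prime_sub q b

theorem exists_natPrime_dvd_norm {l : ℤ[i]} (hl : Prime l) :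
    ∃ q : ℕ, q.Prime ∧ (q : ℤ) ∣ l.norm ∧ l ∣ (q : ℤ[i]) := by
  have hN : l.norm.natAbs ≠ 0 := by simpa using hl.ne_zero
  have hdvd : l ∣ ((l.norm.natAbs.primeFactorsList.map (Nat.cast : ℕ → ℤ[i]))).prod := by
    rw [← Nat.cast_list_prod, Nat.prod_primeFactorsList hN, GaussianInt.natCast_natAbs_norm,
      Zsqrtd.norm_eq_mul_conj]
    exact dvd_mul_right _ _
  obtain ⟨a, ha, hla⟩ := (Prime.dvd_prod_iff hl).1 hdvd
  obtain ⟨q, hq, rfl⟩ := List.mem_map.1 ha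
  exact ⟨q, Nat.prime_of_mem_primeFactorsList hq,
    Int.natCast_dvd.2 (Nat.dvd_of_mem_primeFactorsList hq), hla⟩

theorem norm_eq_or_associated_of_prime {l : ℤ[i]} (hl : Prime l) (ho : Odd l.norm) :
    ∃ q : ℕ, q.Prime ∧ (q % 4 = 1 ∧ l.norm = q ∨ q % 4 = 3 ∧ Associated l (q : ℤ[i])) := by
  obtain ⟨q, hq, hqN, m, hm⟩ := exists_natPrime_dvd_norm hl
  have : Fact q.Prime := ⟨hq⟩
  have hsq : l.norm * m.norm = (q : ℤ) * q := by
    rw [← Zsqrtd.norm_mul, ← hm, Zsqrtd.norm_natCast]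
  obtain ⟨k, hk⟩ := hqN
  have hkm : k * m.norm = q := by
    apply mul_left_cancel₀ (Int.natCast_ne_zero.2 hq.ne_zero)
    rw [← hsq, hk, mul_assoc]
  refine ⟨q, hq, ?_⟩
  rcases (Nat.prime_iff_prime_int.1 hq).irreducible.isUnit_or_isUnit hkm.symm with hu | hu
  · have hk1 : k = 1 := by
      have hpos := GaussianInt.norm_pos.2 hl.ne_zero
      have := pos_of_mul_pos_right (hk ▸ hpos) (Int.natCast_nonneg q)
      rcases Int.isUnit_iff.1 hu with h | h <;> omega
    rw [hk1, mul_one] at hk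
    have := norm_emod_four_of_odd ho
    exact Or.inl ⟨by omega, hk⟩
  · have ha : Associated l (q : ℤ[i]) :=
      hm ▸ (associated_mul_unit_right l m ((Zsqrtd.isUnit_iff_norm_isUnit m).2 hu))
    exact Or.inr ⟨GaussianInt.mod_four_eq_three_of_nat_prime_of_prime q (ha.prime hl), ha⟩

theorem dvd_pow_norm_sub_self {l : ℤ[i]} (hl : Prime l) (ho : Odd l.norm) (b : ℤ[i]) :
    l ∣ b ^ l.norm.natAbs - b := by
  obtain ⟨q, hq, ⟨h4, hn⟩ | ⟨h4, ha⟩⟩ := norm_eq_or_associated_of_prime hl ho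
  · have : Fact q.Prime := ⟨hq⟩
    rw [hn, Int.natAbs_natCast]
    exact (natCast_eq_mul_star hn ▸ dvd_mul_right l _).trans (dvd_pow_sub_self h4 b)
  · have : Fact q.Prime := ⟨hq⟩
    rw [norm_eq_of_associated ha, Zsqrtd.norm_natCast, Int.natAbs_mul, Int.natAbs_natCast, pow_mul]
    have h1 := (dvd_pow_sub_star h4 b).trans (sub_dvd_pow_sub_pow _ _ q)
    have h2 := dvd_pow_sub_star h4 (star b)
    rw [star_star] at h2
    exact ha.dvd.trans (by simpa using dvd_add h1 h2)

/-! ### Powers of `i` -/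

/-- `i` as an element of the unit group, so that it can be raised to integral powers. -/
def gaussIUnit : ℤ[i]ˣ :=
  ⟨gaussI, -gaussI, by linear_combination -gaussI_sq, by linear_combination -gaussI_sq⟩

/-- The integral power `i ^ k`. -/
def iPow (k : ℤ) : ℤ[i] := (gaussIUnit ^ k : ℤ[i]ˣ)

theorem iPow_add (j k : ℤ) : iPow (j + k) = iPow j * iPow k := by
  rw [iPow, zpow_add, Units.val_mul]; rfl

theorem iPow_zero : iPow 0 = 1 := rfl

theorem iPow_one : iPow 1 = gaussI := by rw [iPow, zpow_one]; rfl

theorem iPow_pow (j : ℤ) (n : ℕ) : iPow j ^ n = iPow (j * n) := by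
  rw [iPow, iPow, zpow_mul, zpow_natCast, Units.val_pow_eq_pow_val]

theorem iPow_natCast (k : ℕ) : iPow k = gaussI ^ k := by
  rw [← iPow_one, iPow_pow, one_mul]

theorem iPow_two : iPow 2 = -1 := (iPow_natCast 2).trans gaussI_sq

theorem iPow_congr {j k : ℤ} (h : j ≡ k [ZMOD 4]) : iPow j = iPow k := by
  obtain ⟨m, hm⟩ := h.symm.dvd
  have h4 : gaussIUnit ^ (4 : ℤ) = 1 := by
    ext1
    exact (iPow_natCast 4).trans gaussI_pow_four
  rw [eq_add_of_sub_eq hm, iPow, iPow, zpow_add, zpow_mul, h4, one_zpow, one_mul]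

theorem iPow_pow_four (k : ℤ) : iPow k ^ 4 = 1 := by
  rw [iPow_pow, ← iPow_zero]
  exact iPow_congr (Int.modEq_zero_iff_dvd.2 ⟨k, by push_cast; ring⟩)

theorem iPow_mul_iPow_neg (k : ℤ) : iPow k * iPow (-k) = 1 := by
  rw [← iPow_add, add_neg_cancel, iPow_zero]

theorem iPow_ne_zero (k : ℤ) : iPow k ≠ 0 := Units.ne_zero _

theorem iPow_mul_eq_iff {k : ℤ} {z w : ℤ[i]} : iPow k * z = w ↔ z = iPow (-k) * w := by
  have h := iPow_mul_iPow_neg k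
  constructor <;> rintro rfl
  · linear_combination -z * h
  · linear_combination w * h

theorem star_iPow (k : ℤ) : star (iPow k) = iPow (-k) := by
  have h : ∀ n : ℕ, star (iPow n) = iPow (-n) := fun n => by
    have hI : iPow (-1) = -gaussI := by
      rw [iPow_congr (show -1 ≡ 1 + 2 [ZMOD 4] by decide), iPow_add, iPow_two, iPow_one]
      ring
    rw [iPow_natCast, star_pow, star_gaussI, ← hI, iPow_pow, neg_one_mul]
  have hk : k ≡ (k % 4).toNat [ZMOD 4] := by
    rw [Int.toNat_of_nonneg (Int.emod_nonneg k (by norm_num))]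
    exact (Int.mod_modEq k 4).symm
  rw [iPow_congr hk, h, iPow_congr hk.neg]

theorem pow_five_eq_self_iff {z : ℤ[i]} :
    z ^ 5 = z ↔ z = 0 ∨ z = 1 ∨ z = -1 ∨ z = gaussI ∨ z = -gaussI := by
  constructor
  · intro h
    have hprod : z * ((z - 1) * ((z + 1) * ((z - gaussI) * (z + gaussI)))) = 0 := by
      linear_combination h + (z - z ^ 3) * gaussI_sq
    simpa only [mul_eq_zero, sub_eq_zero, add_eq_zero_iff_eq_neg] using hprod
  · rintro (rfl | rfl | rfl | rfl | rfl)
    · norm_num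
    · norm_num
    · norm_num
    · linear_combination gaussI * gaussI_pow_four
    · linear_combination -gaussI * gaussI_pow_four

theorem eq_iPow_of_pow_four_eq_one {z : ℤ[i]} (h : z ^ 4 = 1) : ∃ k : ℤ, z = iPow k := by
  rcases pow_five_eq_self_iff.1 (by rw [pow_succ, h, one_mul]) with rfl | rfl | rfl | rfl | rfl
  · norm_num at h
  · exact ⟨0, iPow_zero.symm⟩
  · exact ⟨2, iPow_two.symm⟩
  · exact ⟨1, iPow_one.symm⟩
  · exact ⟨2 + 1, by rw [iPow_add, iPow_two, iPow_one, neg_one_mul]⟩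

theorem mul_star_eq_one {z : ℤ[i]} (h : z ^ 4 = 1) : z * star z = 1 := by
  obtain ⟨k, rfl⟩ := eq_iPow_of_pow_four_eq_one h
  rw [star_iPow, iPow_mul_iPow_neg]

theorem ediv_four_mul_modEq {u v : ℤ} (hu : u % 4 = 1) (hv : v % 4 = 1) :
    u * v / 4 ≡ u / 4 + v / 4 [ZMOD 4] := by
  obtain ⟨j, rfl⟩ : ∃ j, u = 4 * j + 1 := ⟨u / 4, by omega⟩
  obtain ⟨k, rfl⟩ : ∃ k, v = 4 * k + 1 := ⟨v / 4, by omega⟩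
  have hmul : (4 * j + 1) * (4 * k + 1) = 4 * (4 * (j * k) + j + k) + 1 := by ring
  rw [hmul, Int.ModEq]
  omega

/-! ### The quartic residue symbol -/

theorem eq_of_dvd_sub_of_pow_five_eq_self {l z w : ℤ[i]} (hl : Prime l) (ho : Odd l.norm)
    (hz : z ^ 5 = z) (hw : w ^ 5 = w) (h : l ∣ z - w) : z = w := by
  by_contra hne
  have hdvd4 : (z - w).norm ∣ 4 := by
    rcases pow_five_eq_self_iff.1 hz with rfl | rfl | rfl | rfl | rfl <;>
    rcases pow_five_eq_self_iff.1 hw with rfl | rfl | rfl | rfl | rfl <;>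
    first
    | exact absurd rfl hne
    | simp [gaussI, Zsqrtd.norm_def]
  have hcop : IsCoprime l.norm (2 ^ 2) := (Int.isCoprime_two_right.2 ho).pow_right
  exact hl.not_isUnit <| (Zsqrtd.isUnit_iff_norm_isUnit l).2 <|
    hcop.isUnit_of_dvd' dvd_rfl ((map_dvd Zsqrtd.normMonoidHom h).trans hdvd4)

theorem five_le_norm_of_prime {l : ℤ[i]} (hl : Prime l) (ho : Odd l.norm) :
    5 ≤ l.norm := by
  have hnu : l.norm ≠ 1 := fun h =>
    hl.not_isUnit ((Zsqrtd.isUnit_iff_norm_isUnit l).2 (by rw [h]; exact isUnit_one))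
  have := norm_emod_four_of_odd ho
  have := GaussianInt.norm_nonneg l
  omega

theorem exists_pow_five_eq_self_dvd_sub {l : ℤ[i]} (hl : Prime l) (ho : Odd l.norm) (b : ℤ[i]) :
    ∃ z : ℤ[i], z ^ 5 = z ∧ l ∣ b ^ (l.norm.natAbs / 4) - z := by
  have hN := five_le_norm_of_prime hl ho
  have h4 := norm_emod_four_of_odd ho
  obtain ⟨e, he⟩ : ∃ e, l.norm.natAbs / 4 = e + 1 := ⟨l.norm.natAbs / 4 - 1, by omega⟩
  have hne : l.norm.natAbs = 4 * (e + 1) + 1 := by omega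
  have hdvd := dvd_pow_norm_sub_self hl ho b
  rw [hne] at hdvd
  rw [he]
  set c := b ^ (e + 1)
  have hfactor : c * ((c - 1) * ((c - -1) * ((c - gaussI) * (c - -gaussI)))) =
      b ^ e * (b ^ (4 * (e + 1) + 1) - b) := by
    linear_combination (c - c ^ 3) * gaussI_sq
  have hprod := hfactor ▸ hdvd.mul_left (b ^ e)
  have hz := fun z => (pow_five_eq_self_iff (z := z)).2
  rcases hl.dvd_or_dvd hprod with h | hprod
  · exact ⟨0, hz _ (by simp), by rwa [sub_zero]⟩
  rcases hl.dvd_or_dvd hprod with h | hprod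
  · exact ⟨1, hz _ (by simp), h⟩
  rcases hl.dvd_or_dvd hprod with h | hprod
  · exact ⟨-1, hz _ (by simp), h⟩
  rcases hl.dvd_or_dvd hprod with h | h
  · exact ⟨gaussI, hz _ (by simp), h⟩
  · exact ⟨-gaussI, hz _ (by simp), h⟩

open Classical in
/-- The quartic residue symbol of `b` modulo an odd Gaussian prime `l`: the element of
`{0, 1, -1, i, -i}`, i.e. the root of `z ^ 5 = z`, that is congruent to `b ^ ((N l - 1) / 4)`.
It is `0` when `l ∣ b`, and also when the norm of `l` is even. -/
noncomputable def quarticPrime (b l : ℤ[i]) : ℤ[i] :=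
  if Odd l.norm then
    Classical.epsilon fun z : ℤ[i] => z ^ 5 = z ∧ l ∣ b ^ (l.norm.natAbs / 4) - z
  else 0

theorem quarticPrime_of_not_odd {l : ℤ[i]} (ho : ¬ Odd l.norm) (b : ℤ[i]) :
    quarticPrime b l = 0 :=
  if_neg ho

theorem quarticPrime_spec {l : ℤ[i]} (hl : Prime l) (ho : Odd l.norm) (b : ℤ[i]) :
    quarticPrime b l ^ 5 = quarticPrime b l ∧
      l ∣ b ^ (l.norm.natAbs / 4) - quarticPrime b l := by
  rw [quarticPrime, if_pos ho]
  exact Classical.epsilon_spec (exists_pow_five_eq_self_dvd_sub hl ho b)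

theorem quarticPrime_eq {l b z : ℤ[i]} (hl : Prime l) (ho : Odd l.norm) (hz : z ^ 5 = z)
    (h : l ∣ b ^ (l.norm.natAbs / 4) - z) : quarticPrime b l = z := by
  obtain ⟨hroot, hdvd⟩ := quarticPrime_spec hl ho b
  refine eq_of_dvd_sub_of_pow_five_eq_self hl ho hroot hz ?_
  simpa using dvd_sub h hdvd

theorem quarticPrime_of_dvd {l b : ℤ[i]} (hl : Prime l) (h : l ∣ b) : quarticPrime b l = 0 := by
  by_cases ho : Odd l.norm
  · have := five_le_norm_of_prime hl ho
    refine quarticPrime_eq hl ho (by norm_num) ?_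
    rw [sub_zero]
    exact dvd_pow h (by omega)
  · exact quarticPrime_of_not_odd ho b

theorem quarticPrime_pow_four {l b : ℤ[i]} (hl : Prime l) (ho : Odd l.norm) (hb : ¬ l ∣ b) :
    quarticPrime b l ^ 4 = 1 := by
  obtain ⟨hroot, hdvd⟩ := quarticPrime_spec hl ho b
  have hne : quarticPrime b l ≠ 0 := by
    intro h0
    rw [h0, sub_zero] at hdvd
    exact hb (hl.dvd_of_dvd_pow hdvd)
  apply mul_left_cancel₀ hne
  linear_combination hroot

theorem quarticPrime_of_associated {l l' : ℤ[i]} (h : Associated l l') (b : ℤ[i]) :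
    quarticPrime b l = quarticPrime b l' := by
  simp only [quarticPrime, norm_eq_of_associated h, h.dvd_iff_dvd_left]

theorem quarticPrime_congr {l b b' : ℤ[i]} (hl : Prime l) (h : l ∣ b - b') :
    quarticPrime b l = quarticPrime b' l := by
  by_cases ho : Odd l.norm
  · obtain ⟨hroot, hdvd⟩ := quarticPrime_spec hl ho b'
    refine quarticPrime_eq hl ho hroot ?_
    simpa using dvd_add (h.trans (sub_dvd_pow_sub_pow b b' (l.norm.natAbs / 4))) hdvd
  · rw [quarticPrime_of_not_odd ho, quarticPrime_of_not_odd ho]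

theorem quarticPrime_mul {l : ℤ[i]} (hl : Prime l) (b c : ℤ[i]) :
    quarticPrime (b * c) l = quarticPrime b l * quarticPrime c l := by
  by_cases ho : Odd l.norm
  · obtain ⟨hb, s, hs⟩ := quarticPrime_spec hl ho b
    obtain ⟨hc, t, ht⟩ := quarticPrime_spec hl ho c
    refine quarticPrime_eq hl ho (by rw [mul_pow, hb, hc])
      ⟨s * c ^ (l.norm.natAbs / 4) + quarticPrime b l * t, ?_⟩
    rw [mul_pow]
    linear_combination hs * c ^ (l.norm.natAbs / 4) + quarticPrime b l * ht
  · simp only [quarticPrime_of_not_odd ho, zero_mul]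

theorem quarticPrime_star {l : ℤ[i]} (hl : Prime l) (b : ℤ[i]) :
    quarticPrime (star b) (star l) = star (quarticPrime b l) := by
  have hn : (star l).norm = l.norm := Zsqrtd.norm_conj l
  by_cases ho : Odd l.norm
  · obtain ⟨hroot, hdvd⟩ := quarticPrime_spec hl ho b
    refine quarticPrime_eq (prime_star hl) (by rwa [hn]) (by rw [← star_pow, hroot]) ?_
    rwa [hn, ← star_pow, ← star_sub, star_dvd_star_iff]
  · rw [quarticPrime_of_not_odd ho, quarticPrime_of_not_odd (by rwa [hn]), star_zero]

open Classical in
/-- The quartic Jacobi symbol `(b / a)₄`, the product of the quartic residue symbols of `b` modulo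
the prime factors of `a`. The values `0` for `a = 0` and for even primes make it multiplicative
in `a` and in `b` without side conditions. -/
noncomputable def quartic (b a : ℤ[i]) : ℤ[i] :=
  if a = 0 then 0 else ((factors a).map (quarticPrime b)).prod

theorem quartic_of_ne_zero {a : ℤ[i]} (ha : a ≠ 0) (b : ℤ[i]) :
    quartic b a = ((factors a).map (quarticPrime b)).prod :=
  if_neg ha

theorem quartic_zero_right (b : ℤ[i]) : quartic b 0 = 0 := if_pos rfl

theorem quartic_mul_right (b a a' : ℤ[i]) : quartic b (a * a') = quartic b a * quartic b a' := by
  rcases eq_or_ne a 0 with rfl | ha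
  · rw [zero_mul, quartic_zero_right, zero_mul]
  rcases eq_or_ne a' 0 with rfl | ha'
  · rw [mul_zero, quartic_zero_right, mul_zero]
  rw [quartic_of_ne_zero ha, quartic_of_ne_zero ha', quartic_of_ne_zero (mul_ne_zero ha ha'),
    ← Multiset.prod_add, ← Multiset.map_add]
  congr 1
  rw [← Multiset.rel_eq, Multiset.rel_map]
  exact (factors_mul ha ha').mono fun _ _ _ _ h => quarticPrime_of_associated h b

theorem quartic_of_isUnit {a : ℤ[i]} (ha : IsUnit a) (b : ℤ[i]) : quartic b a = 1 := by
  rw [quartic_of_ne_zero ha.ne_zero, factors_of_isUnit ha, Multiset.map_zero, Multiset.prod_zero]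

theorem quartic_of_associated {a a' : ℤ[i]} (h : Associated a a') (b : ℤ[i]) :
    quartic b a = quartic b a' := by
  obtain ⟨u, rfl⟩ := h
  rw [quartic_mul_right, quartic_of_isUnit u.isUnit, mul_one]

theorem quartic_prime {l : ℤ[i]} (hl : Prime l) (b : ℤ[i]) : quartic b l = quarticPrime b l := by
  obtain ⟨l', hl', hf⟩ := factors_eq_singleton_of_irreducible hl.irreducible
  rw [quartic_of_ne_zero hl.ne_zero, hf, Multiset.map_singleton, Multiset.prod_singleton,
    quarticPrime_of_associated hl']

theorem quartic_congr {a b b' : ℤ[i]} (h : a ∣ b - b') : quartic b a = quartic b' a := by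
  rcases eq_or_ne a 0 with rfl | ha
  · rw [quartic_zero_right, quartic_zero_right]
  rw [quartic_of_ne_zero ha, quartic_of_ne_zero ha]
  exact congrArg _ (Multiset.map_congr rfl fun l hl =>
    quarticPrime_congr (prime_of_factor l hl) ((dvd_of_mem_factors hl).trans h))

theorem quartic_mul_left (b c a : ℤ[i]) : quartic (b * c) a = quartic b a * quartic c a := by
  rcases eq_or_ne a 0 with rfl | ha
  · simp only [quartic_zero_right, zero_mul]
  rw [quartic_of_ne_zero ha, quartic_of_ne_zero ha, quartic_of_ne_zero ha, ← Multiset.prod_map_mul]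
  exact congrArg _ (Multiset.map_congr rfl fun l hl => quarticPrime_mul (prime_of_factor l hl) b c)

theorem quartic_star (b a : ℤ[i]) : quartic (star b) (star a) = star (quartic b a) := by
  induction a using induction_on_prime with
  | h₁ => rw [star_zero, quartic_zero_right, quartic_zero_right, star_zero]
  | h₂ u hu => rw [quartic_of_isUnit hu, quartic_of_isUnit (isUnit_star.2 hu), star_one]
  | h₃ a l _ hl ih =>
    rw [quartic_mul_right, star_mul, quartic_mul_right, ih, quartic_prime hl,
      quartic_prime (prime_star hl), quarticPrime_star hl, star_mul]

theorem odd_norm_induction {P : ∀ a : ℤ[i], Odd a.norm → Prop}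
    (unit : ∀ u hu, IsUnit u → P u hu)
    (prime_mul : ∀ l a (hl : Odd l.norm) (ha : Odd a.norm), Prime l → P a ha →
      P (l * a) (Zsqrtd.norm_mul l a ▸ hl.mul ha)) (a : ℤ[i]) (ha : Odd a.norm) : P a ha := by
  induction a using induction_on_prime with
  | h₁ => simp at ha
  | h₂ u h => exact unit u ha h
  | h₃ a l _ hl ih =>
    have h := Int.odd_mul.1 (Zsqrtd.norm_mul l a ▸ ha)
    exact prime_mul l a h.1 h.2 hl (ih h.2)

theorem quartic_pow_four {a b : ℤ[i]} (ha : Odd a.norm) (h : IsCoprime b a) :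
    quartic b a ^ 4 = 1 := by
  induction a, ha using odd_norm_induction with
  | unit u _ hu => rw [quartic_of_isUnit hu, one_pow]
  | prime_mul l a ho _ hl ih =>
    rw [quartic_mul_right, mul_pow, ih h.of_mul_right_right, quartic_prime hl,
      quarticPrime_pow_four hl ho (not_dvd_of_isCoprime hl h.of_mul_right_left), one_mul]

theorem quartic_ne_zero {a b : ℤ[i]} (ha : Odd a.norm) (h : IsCoprime b a) : quartic b a ≠ 0 := by
  intro h0
  simpa [h0] using quartic_pow_four ha h

theorem quartic_one_left {a : ℤ[i]} (ha : Odd a.norm) : quartic 1 a = 1 := by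
  have h := quartic_mul_left 1 1 a
  rw [mul_one] at h
  exact (mul_eq_left₀ (quartic_ne_zero ha isCoprime_one_left)).1 h.symm

theorem quartic_pow_left {a : ℤ[i]} (ha : Odd a.norm) (b : ℤ[i]) (n : ℕ) :
    quartic (b ^ n) a = quartic b a ^ n := by
  induction n with
  | zero => simp only [pow_zero, quartic_one_left ha]
  | succ n ih => rw [pow_succ, quartic_mul_left, ih, pow_succ]

/-! ### Rational moduli and supplementary laws -/

theorem quartic_gaussI {a : ℤ[i]} (ha : Odd a.norm) : quartic gaussI a = iPow (a.norm / 4) := by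
  induction a, ha using odd_norm_induction with
  | unit u _ hu =>
    rw [quartic_of_isUnit hu, norm_eq_of_associated (associated_one_iff_isUnit.2 hu)]
    rfl
  | prime_mul l a ho ha hl ih =>
    have hprime : quarticPrime gaussI l = iPow (l.norm / 4) := by
      refine quarticPrime_eq hl ho (by rw [pow_succ, iPow_pow_four, one_mul]) ?_
      have hexp : l.norm / 4 = (l.norm.natAbs / 4 : ℕ) := by
        rw [Int.natCast_div, GaussianInt.abs_natCast_norm, Nat.cast_ofNat]
      rw [hexp, iPow_natCast, sub_self]
      exact dvd_zero _
    rw [quartic_mul_right, quartic_prime hl, hprime, ih, ← iPow_add, Zsqrtd.norm_mul]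
    exact iPow_congr
      (ediv_four_mul_modEq (norm_emod_four_of_odd ho) (norm_emod_four_of_odd ha)).symm

theorem quartic_neg_one {a : ℤ[i]} (ha : Odd a.norm) :
    quartic (-1) a = iPow (a.norm / 2) := by
  rw [← gaussI_sq, quartic_pow_left ha, quartic_gaussI ha, iPow_pow]
  have := norm_emod_four_of_odd ha
  exact congrArg iPow (by push_cast; omega)

theorem isCoprime_intCast {m n : ℤ} (h : IsCoprime m n) : IsCoprime (m : ℤ[i]) (n : ℤ[i]) :=
  h.map (Int.castRingHom ℤ[i])

theorem isCoprime_two_of_odd_norm {a : ℤ[i]} (h : Odd a.norm) : IsCoprime (2 : ℤ[i]) a := by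
  have hcop := isCoprime_intCast (Int.isCoprime_two_left.2 h)
  rw [Zsqrtd.norm_eq_mul_conj] at hcop
  exact_mod_cast hcop.of_mul_right_left

theorem isCoprime_one_add_gaussI {a : ℤ[i]} (h : Odd a.norm) : IsCoprime (1 + gaussI) a :=
  (isCoprime_two_of_odd_norm h).of_isCoprime_of_dvd_left
    ⟨1 - gaussI, by linear_combination gaussI_sq⟩

theorem star_one_add_gaussI : star (1 + gaussI) = 1 - gaussI := by
  rw [star_add, star_one, star_gaussI, sub_eq_add_neg]

theorem quartic_natCast_of_norm_eq {q : ℕ} {l : ℤ[i]} (hn : l.norm = q) (b : ℤ[i]) :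
    quartic b q = quartic b l * star (quartic (star b) l) := by
  rw [natCast_eq_mul_star hn, quartic_mul_right, ← quartic_star, star_star]

theorem norm_natCast_natAbs_div_four {q : ℕ} (h4 : q % 4 = 3) :
    (q : ℤ[i]).norm.natAbs / 4 = (q - 1) * ((q + 1) / 4) := by
  obtain ⟨k, rfl⟩ : ∃ k, q = 4 * k + 3 := ⟨q / 4, by omega⟩
  have hsq : (4 * k + 3) * (4 * k + 3) = 4 * ((4 * k + 2) * (k + 1)) + 1 := by ring
  rw [Zsqrtd.norm_natCast, Int.natAbs_mul, Int.natAbs_natCast, hsq,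
    show (4 * k + 3 + 1) / 4 = k + 1 by omega, show 4 * k + 3 - 1 = 4 * k + 2 by omega]
  omega

theorem quartic_natPrime_three_mod_four {q : ℕ} [Fact q.Prime] (h4 : q % 4 = 3)
    {b z w : ℤ[i]} (h : (q : ℤ[i]) ∣ b ^ (q - 1) - w) (hz : w ^ ((q + 1) / 4) = z)
    (hz4 : z ^ 4 = 1) : quartic b q = z := by
  have hq : Prime (q : ℤ[i]) := GaussianInt.prime_of_nat_prime_of_mod_four_eq_three q h4
  have ho : Odd (q : ℤ[i]).norm := by
    exact_mod_cast odd_norm_intCast (n := q) (Int.odd_iff.2 (by omega))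
  rw [quartic_prime hq]
  refine quarticPrime_eq hq ho (by rw [pow_succ, hz4, one_mul]) ?_
  rw [norm_natCast_natAbs_div_four h4, pow_mul, ← hz]
  exact h.trans (sub_dvd_pow_sub_pow _ _ _)

theorem quartic_intCast_natPrime {q : ℕ} [hq : Fact q.Prime] (ho : Odd q) {m : ℤ}
    (hm : IsCoprime m q) : quartic m q = 1 := by
  rcases Nat.odd_mod_four_iff.1 (Nat.odd_iff.1 ho) with h4 | h4
  · obtain ⟨l, -, hn⟩ := exists_prime_norm_eq h4
    have hml : IsCoprime (m : ℤ[i]) l := by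
      have hcop := isCoprime_intCast hm
      rw [Int.cast_natCast, natCast_eq_mul_star hn] at hcop
      exact hcop.of_mul_right_left
    have hol : Odd l.norm := by rw [hn]; exact_mod_cast ho
    rw [quartic_natCast_of_norm_eq hn, star_intCast]
    exact mul_star_eq_one (quartic_pow_four hol hml)
  · refine quartic_natPrime_three_mod_four h4 (w := 1) ?_ (one_pow _) (one_pow 4)
    have hdvd : (q : ℤ) ∣ m ^ (q - 1) - 1 :=
      (Int.ModEq.pow_card_sub_one_eq_one hq.out hm).symm.dvd
    simpa using (Int.castRingHom ℤ[i]).map_dvd hdvd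

theorem odd_int_induction {P : ∀ n : ℤ, Odd n → Prop} (one : P 1 odd_one)
    (neg : ∀ n hn, P n hn → P (-n) hn.neg)
    (prime_mul : ∀ (q : ℕ) (n : ℤ) (hq : Odd q) (hn : Odd n), q.Prime → P n hn →
      P (q * n) (((Int.odd_coe_nat q).2 hq).mul hn)) (n : ℤ) (hn : Odd n) : P n hn := by
  have hnat : ∀ n : ℕ, ∀ hn : Odd (n : ℤ), P n hn := by
    intro n
    induction n using induction_on_primes with
    | zero => intro hn; simp at hn
    | one => exact fun _ => one
    | prime_mul q n hq ih =>
      intro hn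
      have h := Nat.odd_mul.1 ((Int.odd_coe_nat _).1 hn)
      simp only [Nat.cast_mul]
      exact prime_mul q n h.1 ((Int.odd_coe_nat n).2 h.2) hq (ih _)
  obtain ⟨k, rfl | rfl⟩ := Int.eq_nat_or_neg n
  · exact hnat k hn
  · exact neg k (by simpa using hn) (hnat k _)

theorem quartic_neg_right (b a : ℤ[i]) : quartic b (-a) = quartic b a :=
  quartic_of_associated (Associated.refl a).neg_left b

theorem quartic_intCast_intCast {m n : ℤ} (hn : Odd n) (h : IsCoprime m n) :
    quartic m n = 1 := by
  induction n, hn using odd_int_induction with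
  | one => exact quartic_of_isUnit (by simp) _
  | neg n _ ih => rw [Int.cast_neg, quartic_neg_right, ih ((IsCoprime.neg_right_iff m n).1 h)]
  | prime_mul q n ho _ hq ih =>
    have : Fact q.Prime := ⟨hq⟩
    rw [Int.cast_mul, Int.cast_natCast, quartic_mul_right,
      quartic_intCast_natPrime ho h.of_mul_right_left, ih h.of_mul_right_right, one_mul]

theorem quartic_intCast_mul {m n : ℤ} (hn : Odd n) (h : IsCoprime m n) (b : ℤ[i]) :
    quartic (m * b) n = quartic b n := by
  rw [quartic_mul_left, quartic_intCast_intCast hn h, one_mul]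

theorem χ₄_eq_or {n : ℤ} (hn : Odd n) :
    ZMod.χ₄ n = 1 ∧ n % 4 = 1 ∨ ZMod.χ₄ n = -1 ∧ n % 4 = 3 := by
  rcases (by have := Int.odd_iff.1 hn; omega : n % 4 = 1 ∨ n % 4 = 3) with h | h
  · exact Or.inl ⟨ZMod.χ₄_int_one_mod_four h, h⟩
  · exact Or.inr ⟨ZMod.χ₄_int_three_mod_four h, h⟩

theorem χ₄_sq {n : ℤ} (hn : Odd n) : ZMod.χ₄ n ^ 2 = 1 := by
  rcases χ₄_eq_or hn with ⟨h, -⟩ | ⟨h, -⟩ <;> rw [h] <;> rfl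

theorem χ₄_mul_self_emod_four {n : ℤ} (hn : Odd n) : ZMod.χ₄ n * n % 4 = 1 := by
  rcases χ₄_eq_or hn with ⟨h, h4⟩ | ⟨h, h4⟩ <;> rw [h] <;> omega

theorem χ₄_neg_mul_neg (n : ℤ) : ZMod.χ₄ (-n : ℤ) * -n = ZMod.χ₄ n * n := by
  have h : ZMod.χ₄ (-n : ℤ) = -ZMod.χ₄ n := by
    rw [Int.cast_neg, neg_eq_neg_one_mul, map_mul, neg_eq_neg_one_mul (ZMod.χ₄ n)]
    rfl
  rw [h, neg_mul_neg]

theorem quartic_one_add_gaussI_natPrime {q : ℕ} [Fact q.Prime] (ho : Odd q) :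
    quartic (1 + gaussI) q = iPow (ZMod.χ₄ (q : ℤ) * q / 4) := by
  rcases χ₄_eq_or ((Int.odd_coe_nat q).2 ho) with ⟨hχ, h4⟩ | ⟨hχ, h4⟩
  · obtain ⟨l, -, hn⟩ := exists_prime_norm_eq (show q % 4 = 1 by omega)
    have hol : Odd l.norm := by rw [hn]; exact_mod_cast ho
    have hassoc : 1 + gaussI = gaussI * star (1 + gaussI) := by
      rw [star_one_add_gaussI]; linear_combination gaussI_sq
    have hcop := isCoprime_one_add_gaussI hol
    rw [hassoc] at hcop
    rw [quartic_natCast_of_norm_eq hn, hχ, one_mul]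
    nth_rw 1 [hassoc]
    rw [quartic_mul_left, mul_assoc, mul_star_eq_one (quartic_pow_four hol hcop.of_mul_left_right),
      mul_one, quartic_gaussI hol, hn]
  · have hq : Prime (q : ℤ[i]) :=
      GaussianInt.prime_of_nat_prime_of_mod_four_eq_three q (by omega)
    have hoq : Odd (q : ℤ[i]).norm := by
      exact_mod_cast odd_norm_intCast ((Int.odd_coe_nat q).2 ho)
    have hfrob : (q : ℤ[i]) ∣ (1 + gaussI) ^ (q - 1) - iPow (-1) := by
      have h := dvd_pow_sub_star (q := q) (by omega) (1 + gaussI)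
      have hfactor : (1 + gaussI) ^ q - star (1 + gaussI) =
          (1 + gaussI) * ((1 + gaussI) ^ (q - 1) - iPow (-1)) := by
        rw [mul_sub, ← pow_succ', Nat.sub_add_cancel (Fact.out : q.Prime).one_le,
          star_one_add_gaussI, ← star_iPow, iPow_one, star_gaussI]
        linear_combination -gaussI_sq
      rw [hfactor] at h
      exact (hq.dvd_or_dvd h).resolve_left (not_dvd_of_isCoprime hq (isCoprime_one_add_gaussI hoq))
    refine quartic_natPrime_three_mod_four (by omega) hfrob ?_ (iPow_pow_four _)
    rw [iPow_pow, hχ]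
    exact congrArg iPow (by push_cast; omega)

theorem quartic_one_add_gaussI {n : ℤ} (hn : Odd n) :
    quartic (1 + gaussI) n = iPow (ZMod.χ₄ n * n / 4) := by
  induction n, hn using odd_int_induction with
  | one => exact quartic_of_isUnit (by simp) _
  | neg n hn ih =>
    rw [Int.cast_neg, quartic_neg_right, ih, χ₄_neg_mul_neg]
  | prime_mul q n ho hn hq ih =>
    have : Fact q.Prime := ⟨hq⟩
    have hoq := (Int.odd_coe_nat q).2 ho
    rw [Int.cast_mul, Int.cast_natCast, quartic_mul_right, quartic_one_add_gaussI_natPrime ho, ih,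
      ← iPow_add, Int.cast_mul, map_mul, mul_mul_mul_comm]
    exact iPow_congr
      (ediv_four_mul_modEq (χ₄_mul_self_emod_four hoq) (χ₄_mul_self_emod_four hn)).symm

theorem quartic_one_sub_gaussI {n : ℤ} (hn : Odd n) :
    quartic (1 - gaussI) n = iPow (-(ZMod.χ₄ n * n / 4)) := by
  rw [← star_one_add_gaussI, ← star_iPow, ← quartic_one_add_gaussI hn, ← quartic_star,
    star_intCast]

/-! ### The quartic character, its Jacobi sum and its Gauss sums -/

open Polynomial in
theorem sum_pow_mul_one_sub_pow_eq_zero {K : Type*} [Field K] [Fintype K] {k : ℕ}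
    (hk : 2 * k < Fintype.card K - 1) : ∑ t : K, t ^ k * (1 - t) ^ k = 0 := by
  have hdeg : (X ^ k * (1 - X) ^ k : K[X]).natDegree < 2 * k + 1 := by
    have h1 : (1 - X : K[X]).natDegree ≤ 1 := (natDegree_sub_le _ _).trans (by simp)
    have := natDegree_mul_le_of_le (natDegree_X_pow_le (R := K) k) (natDegree_pow_le_of_le k h1)
    omega
  have hexpand : ∀ t : K, t ^ k * (1 - t) ^ k =
      ∑ j ∈ Finset.range (2 * k + 1), (X ^ k * (1 - X) ^ k : K[X]).coeff j * t ^ j := fun t => by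
    rw [← eval_eq_sum_range' hdeg t]
    simp
  rw [Finset.sum_congr rfl fun t _ => hexpand t, Finset.sum_comm]
  refine Finset.sum_eq_zero fun j hj => ?_
  rw [Finset.mem_range] at hj
  rw [← Finset.mul_sum, FiniteField.sum_pow_lt_card_sub_one _ _ (by omega), mul_zero]

section QuarticChar

variable {l : ℤ[i]} {p : ℕ} [hp : Fact p.Prime]

theorem dvd_intCast_sub_intCast_iff (hn : l.norm = p) (m n : ℤ) :
    l ∣ (m : ℤ[i]) - n ↔ (m : ZMod p) = n := by
  rw [← Int.cast_sub, dvd_intCast_iff hp.out hn, ← ZMod.intCast_zmod_eq_zero_iff_dvd,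
    Int.cast_sub, sub_eq_zero]

/-- The quartic residue symbol modulo a Gaussian prime of norm `p`, as a character of
`ZMod p`. -/
noncomputable def quarticChar (hl : Prime l) (ho : Odd l.norm) (hn : l.norm = p) :
    MulChar (ZMod p) ℤ[i] where
  toFun t := quarticPrime (t.val : ℤ) l
  map_one' := by
    have h : l ∣ (((1 : ZMod p).val : ℤ) : ℤ[i]) - (1 : ℤ) := by
      rw [dvd_intCast_sub_intCast_iff hn]; simp
    rw [quarticPrime_congr hl h, ← quartic_prime hl, Int.cast_one, quartic_one_left ho]
  map_mul' a b := by
    rw [← quarticPrime_mul hl, ← Int.cast_mul]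
    refine quarticPrime_congr hl ((dvd_intCast_sub_intCast_iff hn _ _).2 ?_)
    simp
  map_nonunit' a ha := by
    obtain rfl : a = 0 := by rwa [isUnit_iff_ne_zero, not_not] at ha
    exact quarticPrime_of_dvd hl (by simp)

theorem ringChar_zmod_ne_two (ho : Odd l.norm) (hn : l.norm = p) : ringChar (ZMod p) ≠ 2 := by
  intro h
  rw [ZMod.ringChar_zmod_n] at h
  rw [hn, h] at ho
  exact absurd ho (by decide)

theorem quarticPrime_intCast_sq (hl : Prime l) (ho : Odd l.norm) (hn : l.norm = p) (m : ℤ) :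
    quarticPrime m l ^ 2 = (quadraticChar (ZMod p) m : ℤ) := by
  have h4 := norm_emod_four_of_odd ho
  obtain ⟨hroot, hdvd⟩ := quarticPrime_spec hl ho m
  refine eq_of_dvd_sub_of_pow_five_eq_self hl ho (by rw [pow_right_comm, hroot]) ?_ ?_
  · rcases quadraticChar_isQuadratic (ZMod p) m with h | h | h <;> rw [h] <;> norm_num
  · have hexp : p / 2 = l.norm.natAbs / 4 * 2 := by
      rw [hn] at h4 ⊢
      rw [Int.natAbs_natCast]
      omega
    have heuler : l ∣ ((m ^ (p / 2) : ℤ) : ℤ[i]) - (quadraticChar (ZMod p) m : ℤ) := by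
      rw [dvd_intCast_sub_intCast_iff hn,
        quadraticChar_eq_pow_of_char_ne_two' (ringChar_zmod_ne_two ho hn), ZMod.card, Int.cast_pow]
    have hsq := hdvd.trans (sub_dvd_pow_sub_pow _ _ 2)
    rw [← pow_mul, ← hexp, ← Int.cast_pow] at hsq
    simpa only [sub_sub_sub_cancel_left] using dvd_sub heuler hsq

variable (hl : Prime l) (ho : Odd l.norm) (hn : l.norm = p)

theorem quarticChar_intCast (m : ℤ) : quarticChar hl ho hn m = quarticPrime m l := by
  refine quarticPrime_congr hl ((dvd_intCast_sub_intCast_iff hn _ _).2 ?_)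
  simp

theorem quarticChar_sq :
    quarticChar hl ho hn ^ 2 = (quadraticChar (ZMod p)).ringHomComp (Int.castRingHom ℤ[i]) := by
  refine MulChar.ext' fun t => ?_
  obtain ⟨m, rfl⟩ := ZMod.intCast_surjective t
  rw [MulChar.pow_apply' _ two_ne_zero, quarticChar_intCast, quarticPrime_intCast_sq hl ho hn]
  rfl

theorem quarticChar_pow_four : quarticChar hl ho hn ^ 4 = 1 := by
  rw [pow_mul _ 2 2, quarticChar_sq, ((quadraticChar_isQuadratic _).comp _).sq_eq_one]

theorem quarticChar_apply_pow_four {t : ZMod p} (ht : t ≠ 0) : quarticChar hl ho hn t ^ 4 = 1 := by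
  rw [← MulChar.pow_apply' _ four_ne_zero, quarticChar_pow_four,
    MulChar.one_apply (isUnit_iff_ne_zero.2 ht)]

theorem quarticChar_ringHomComp_sq {R : Type*} [CommRing R] (f : ℤ[i] →+* R) :
    (quarticChar hl ho hn).ringHomComp f ^ 2 =
      (quadraticChar (ZMod p)).ringHomComp (Int.castRingHom R) := by
  rw [MulChar.ringHomComp_pow, quarticChar_sq]
  exact MulChar.ext fun t => map_intCast f _

theorem quarticChar_ringHomComp_sq_ne_one {R : Type*} [CommRing R] (f : ℤ[i] →+* R)
    (h2 : (2 : R) ≠ 0) : (quarticChar hl ho hn).ringHomComp f ^ 2 ≠ 1 := by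
  intro h
  obtain ⟨t, ht⟩ := quadraticChar_exists_neg_one' (ringChar_zmod_ne_two ho hn)
  have h1 := DFunLike.congr_fun h (t : ZMod p)
  rw [quarticChar_ringHomComp_sq, MulChar.ringHomComp_apply, ht, MulChar.one_apply_coe] at h1
  rw [map_neg, map_one] at h1
  exact h2 (by linear_combination -h1)

theorem quarticChar_ringHomComp_ne_one {R : Type*} [CommRing R] (f : ℤ[i] →+* R)
    (h2 : (2 : R) ≠ 0) : (quarticChar hl ho hn).ringHomComp f ≠ 1 := by
  intro h
  exact quarticChar_ringHomComp_sq_ne_one hl ho hn f h2 (by rw [h, one_pow])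

/-- The Jacobi sum `J(χ, χ)` of the quartic character `χ` modulo a Gaussian prime. -/
noncomputable def quarticJacobiSum : ℤ[i] :=
  jacobiSum (quarticChar hl ho hn) (quarticChar hl ho hn)

theorem dvd_quarticJacobiSum : l ∣ quarticJacobiSum hl ho hn := by
  set k := l.norm.natAbs / 4 with hk
  have hpow : l ∣ ((∑ t : ZMod p, (t.val : ℤ) ^ k * ((1 - t).val : ℤ) ^ k : ℤ) : ℤ[i]) := by
    rw [dvd_intCast_iff hp.out hn, ← ZMod.intCast_zmod_eq_zero_iff_dvd]
    push_cast
    simp only [ZMod.natCast_val, ZMod.cast_id', id_eq]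
    refine sum_pow_mul_one_sub_pow_eq_zero ?_
    have := five_le_norm_of_prime hl ho
    rw [hn] at this
    rw [ZMod.card, hk, hn, Int.natAbs_natCast]
    omega
  have hdiff : l ∣ ∑ t : ZMod p, (((t.val : ℤ) : ℤ[i]) ^ k * (((1 - t).val : ℤ) : ℤ[i]) ^ k -
      quarticChar hl ho hn t * quarticChar hl ho hn (1 - t)) := by
    refine Finset.dvd_sum fun t _ => ?_
    obtain ⟨a, ha⟩ := (quarticPrime_spec hl ho (t.val : ℤ)).2
    obtain ⟨b, hb⟩ := (quarticPrime_spec hl ho ((1 - t).val : ℤ)).2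
    refine ⟨a * (((1 - t).val : ℤ) : ℤ[i]) ^ k + quarticPrime (t.val : ℤ) l * b, ?_⟩
    change _ - quarticPrime _ l * quarticPrime _ l = _
    linear_combination ha * (((1 - t).val : ℤ) : ℤ[i]) ^ k +
      quarticPrime (t.val : ℤ) l * hb
  rw [Finset.sum_sub_distrib] at hdiff
  push_cast at hpow hdiff
  simpa only [quarticJacobiSum, jacobiSum, sub_sub_cancel] using dvd_sub hpow hdiff

theorem jacobiSum_quarticChar_inv :
    jacobiSum (quarticChar hl ho hn)⁻¹ (quarticChar hl ho hn)⁻¹ =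
      star (quarticJacobiSum hl ho hn) := by
  have hinv : (quarticChar hl ho hn)⁻¹ =
      (quarticChar hl ho hn).ringHomComp (starRingEnd ℤ[i]) := by
    rw [inv_eq_iff_mul_eq_one]
    refine MulChar.ext fun t => ?_
    rw [MulChar.mul_apply, MulChar.ringHomComp_apply, MulChar.one_apply_coe]
    exact mul_star_eq_one (quarticChar_apply_pow_four hl ho hn t.ne_zero)
  rw [hinv, jacobiSum_ringHomComp]
  rfl

theorem quarticJacobiSum_mul_star :
    quarticJacobiSum hl ho hn * star (quarticJacobiSum hl ho hn) = p := by
  have hne := quarticChar_ringHomComp_ne_one hl ho hn GaussianInt.toComplex two_ne_zero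
  have h := jacobiSum_mul_jacobiSum_inv
    (by rw [ZMod.ringChar_zmod_n, ringChar.eq_zero]; exact hp.out.ne_zero.symm) hne hne
    (by rw [← pow_two]; exact quarticChar_ringHomComp_sq_ne_one hl ho hn _ two_ne_zero)
  rw [MulChar.ringHomComp_inv, jacobiSum_ringHomComp, jacobiSum_ringHomComp, ← map_mul,
    jacobiSum_quarticChar_inv, ZMod.card] at h
  apply GaussianInt.toComplex_injective
  rw [map_natCast, ← h]
  rfl

theorem exists_quarticJacobiSum_eq : ∃ z : ℤ[i], quarticJacobiSum hl ho hn = -1 + 2 * z := by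
  have hroot : IsPrimitiveRoot gaussI 4 := by
    rw [IsPrimitiveRoot.iff (by norm_num)]
    refine ⟨gaussI_pow_four, fun k hk0 hk4 => ?_⟩
    interval_cases k <;> decide
  have hcard : 4 ∣ Fintype.card (ZMod p) - 1 := by
    have := norm_emod_four_of_odd ho
    rw [hn] at this
    rw [ZMod.card]
    omega
  obtain ⟨z, -, hz⟩ := exists_jacobiSum_eq_neg_one_add (by norm_num)
    (quarticChar_pow_four hl ho hn) (quarticChar_pow_four hl ho hn) hcard hroot
  exact ⟨-(z * gaussI), by rw [quarticJacobiSum, hz]; linear_combination z * gaussI_sq⟩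

section GaussSum

variable {q : ℕ} [hq : Fact q.Prime]

theorem natCast_zmod_ne_zero (hpq : p ≠ q) : (q : ZMod p) ≠ 0 := by
  rw [Ne, ZMod.natCast_eq_zero_iff, Nat.prime_dvd_prime_iff_eq hp.out hq.out]
  exact hpq

theorem gaussSum_pow_char {R : Type*} [CommRing R] [CharP R q] (hpq : p ≠ q)
    (χ : MulChar (ZMod p) R) (ψ : AddChar (ZMod p) R) :
    gaussSum χ ψ ^ q = (χ ^ q)⁻¹ q * gaussSum (χ ^ q) ψ := by
  rw [gaussSum_frob, AddChar.pow_mulShift]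
  exact gaussSum_mulShift_eq (χ ^ q) ψ (Units.mk0 _ (natCast_zmod_ne_zero hpq))

variable {R : Type*} [Field R] [CharP R q] (f : ℤ[i] →+* R) {ψ : AddChar (ZMod p) R}

theorem gaussSum_quarticChar_pow_four (h2 : (2 : R) ≠ 0) (hψ : ψ.IsPrimitive) :
    gaussSum ((quarticChar hl ho hn).ringHomComp f) ψ ^ 4 =
      p * f (quarticJacobiSum hl ho hn) ^ 2 := by
  set χ := (quarticChar hl ho hn).ringHomComp f with hχ
  have hne : χ ^ 2 ≠ 1 := quarticChar_ringHomComp_sq_ne_one hl ho hn f h2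
  have hjacobi := jacobiSum_mul_nontrivial (χ := χ) (φ := χ) (by rwa [← pow_two]) ψ
  rw [hχ, jacobiSum_ringHomComp, ← hχ, ← pow_two, ← pow_two] at hjacobi
  have hquad : (χ ^ 2).IsQuadratic := by
    rw [hχ, quarticChar_ringHomComp_sq]
    exact (quadraticChar_isQuadratic _).comp _
  have hsq := gaussSum_sq hne hquad hψ
  rw [MulChar.pow_apply' _ two_ne_zero, ← map_pow, neg_one_sq, map_one, one_mul,
    ZMod.card] at hsq
  rw [pow_mul _ 2 2, ← hjacobi, mul_pow, hsq, quarticJacobiSum]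

theorem quarticChar_mul_pow_of_one_mod_four (hpq : p ≠ q) (h4 : q % 4 = 1)
    (hψ : ψ.IsPrimitive) :
    f (quarticChar hl ho hn q) * (p * f (quarticJacobiSum hl ho hn) ^ 2) ^ (q / 4) = 1 := by
  have h2 : (2 : R) ≠ 0 := Ring.two_ne_zero (by rw [ringChar.eq R q]; omega)
  have hpR : (Fintype.card (ZMod p) : R) ≠ 0 := by
    rw [ZMod.card, Ne, CharP.cast_eq_zero_iff R q, Nat.prime_dvd_prime_iff_eq hq.out hp.out]
    exact hpq.symm
  set χ := (quarticChar hl ho hn).ringHomComp f with hχ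
  have hχq : χ ^ q = χ := by
    rw [← Nat.div_add_mod q 4, h4, pow_succ, pow_mul, hχ, MulChar.ringHomComp_pow,
      quarticChar_pow_four, MulChar.ringHomComp_one, one_pow, one_mul]
  have hfrob := gaussSum_pow_char hpq χ ψ
  rw [hχq] at hfrob
  have hinv : χ q * χ⁻¹ q = 1 := by
    rw [← MulChar.mul_apply, mul_inv_cancel,
      MulChar.one_apply (natCast_zmod_ne_zero hpq).isUnit]
  have hg : gaussSum χ ψ ≠ 0 := gaussSum_ne_zero_of_nontrivial hpR
    (quarticChar_ringHomComp_ne_one hl ho hn f h2) hψ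
  rw [← gaussSum_quarticChar_pow_four hl ho hn f h2 hψ, ← pow_mul]
  apply mul_right_cancel₀ hg
  have hexp : gaussSum χ ψ ^ (4 * (q / 4)) * gaussSum χ ψ = gaussSum χ ψ ^ q := by
    rw [← pow_succ]; congr 1; omega
  rw [mul_assoc, hexp, hfrob, ← mul_assoc, one_mul, ← MulChar.ringHomComp_apply, hinv, one_mul]

theorem pow_eq_quarticChar_neg_of_three_mod_four (hpq : p ≠ q) (h4 : q % 4 = 3)
    (hψ : ψ.IsPrimitive) :
    (p * f (quarticJacobiSum hl ho hn) ^ 2) ^ ((q + 1) / 4) =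
      f (quarticChar hl ho hn (-q)) * p := by
  have h2 : (2 : R) ≠ 0 := Ring.two_ne_zero (by rw [ringChar.eq R q]; omega)
  set χ := (quarticChar hl ho hn).ringHomComp f with hχ
  have hχq : χ ^ q = χ⁻¹ := by
    rw [eq_inv_iff_mul_eq_one, ← pow_succ, show q + 1 = 4 * ((q + 1) / 4) by omega, pow_mul, hχ,
      MulChar.ringHomComp_pow, quarticChar_pow_four, MulChar.ringHomComp_one, one_pow]
  have hfrob := gaussSum_pow_char hpq χ ψ
  rw [hχq, inv_inv] at hfrob
  have hcard := gaussSum_mul_gaussSum_eq_card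
    (quarticChar_ringHomComp_ne_one hl ho hn f h2) hψ
  rw [← hχ, ZMod.card] at hcard
  have hneg : χ⁻¹ (-1) * gaussSum χ⁻¹ ψ⁻¹ = gaussSum χ⁻¹ ψ := mul_gaussSum_inv_eq_gaussSum _ _
  rw [← gaussSum_quarticChar_pow_four hl ho hn f h2 hψ, ← pow_mul,
    show 4 * ((q + 1) / 4) = q + 1 by omega, pow_succ, hfrob, ← hneg, MulChar.inv_apply',
    inv_neg_one, ← MulChar.ringHomComp_apply, ← hχ, neg_eq_neg_one_mul (q : ZMod p), map_mul,
    ← hcard]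
  ring

end GaussSum

section Reciprocity

variable {q : ℕ} [hq : Fact q.Prime]

theorem exists_primitive_addChar {κ : ℤ[i]} (hκ : Prime κ) (hdvd : κ ∣ (q : ℤ[i]))
    (hpq : p ≠ q) :
    ∃ (R : Type) (_ : Field R) (_ : CharP R q) (f : ℤ[i] →+* R) (ψ : AddChar (ZMod p) R),
      ψ.IsPrimitive ∧ ∀ a b, f a = f b ↔ κ ∣ a - b := by
  have : (Ideal.span {κ}).IsMaximal :=
    PrincipalIdealRing.isMaximal_of_irreducible hκ.irreducible
  let : Field (ℤ[i] ⧸ Ideal.span {κ}) := Ideal.Quotient.field _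
  have hchar : CharP (ℤ[i] ⧸ Ideal.span {κ}) q := by
    refine (CharP.charP_iff_prime_eq_zero hq.out).2 ?_
    rwa [← map_natCast (Ideal.Quotient.mk _), Ideal.Quotient.eq_zero_iff_dvd]
  let ψ := AddChar.FiniteField.primitiveChar (ZMod p) (ℤ[i] ⧸ Ideal.span {κ})
    (by rw [ZMod.ringChar_zmod_n, ringChar.eq _ q]; exact hpq.symm)
  refine ⟨CyclotomicField ψ.n (ℤ[i] ⧸ Ideal.span {κ}), inferInstance,
    charP_of_injective_algebraMap (algebraMap (ℤ[i] ⧸ Ideal.span {κ}) _).injective q,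
    (algebraMap (ℤ[i] ⧸ Ideal.span {κ}) _).comp (Ideal.Quotient.mk _), ψ.char, ψ.prim,
    fun a b => ?_⟩
  rw [RingHom.comp_apply, RingHom.comp_apply,
    (algebraMap (ℤ[i] ⧸ Ideal.span {κ}) _).injective.eq_iff,
    Ideal.Quotient.mk_eq_mk_iff_sub_mem, Ideal.mem_span_singleton]

theorem isCoprime_quarticJacobiSum (hpq : p ≠ q) : IsCoprime (quarticJacobiSum hl ho hn) q := by
  have h := isCoprime_intCast
    (Nat.isCoprime_iff_coprime.2 ((Nat.coprime_primes hp.out hq.out).2 hpq))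
  rw [Int.cast_natCast, Int.cast_natCast, ← quarticJacobiSum_mul_star hl ho hn] at h
  exact h.of_mul_left_left

theorem quartic_quarticJacobiSum_of_one_mod_four (hpq : p ≠ q) (h4 : q % 4 = 1) :
    quartic (quarticJacobiSum hl ho hn) q = quarticChar hl ho hn q := by
  obtain ⟨κ, hκ, hκn⟩ := exists_prime_norm_eq h4
  have hκo : Odd κ.norm := by rw [hκn, Int.odd_coe_nat]; exact Nat.odd_iff.2 (by omega)
  have hκq : (q : ℤ[i]) = κ * star κ := natCast_eq_mul_star hκn
  obtain ⟨R, _, _, f, ψ, hψ, hf⟩ :=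
    exists_primitive_addChar (p := p) hκ (hκq ▸ dvd_mul_right _ _) hpq
  set J := quarticJacobiSum hl ho hn with hJ
  set t := quarticChar hl ho hn q with ht
  have ht4 : t ^ 4 = 1 := quarticChar_apply_pow_four hl ho hn (natCast_zmod_ne_zero hpq)
  have hJκ : IsCoprime J κ :=
    (hκq ▸ isCoprime_quarticJacobiSum hl ho hn hpq).of_mul_right_left
  have hJκ' : IsCoprime (star J) κ := by
    have h := (hκq ▸ isCoprime_quarticJacobiSum hl ho hn hpq).of_mul_right_right.map
      (starRingEnd ℤ[i])
    rwa [starRingEnd_apply, starRingEnd_apply, star_star] at h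
  have hJ4 := quartic_pow_four hκo hJκ
  have hJ4' := quartic_pow_four hκo hJκ'
  have hpJ : f (t * quartic (J ^ 3 * star J) κ) = f 1 := by
    have hsum := quarticChar_mul_pow_of_one_mod_four hl ho hn f hpq h4 hψ
    have hval := (hf _ _).2 (quarticPrime_spec hκ hκo (J ^ 3 * star J)).2
    rw [map_mul, quartic_prime hκ, ← hval, map_one, ← hsum, hκn, Int.natAbs_natCast, map_pow,
      ← map_natCast f p, ← quarticJacobiSum_mul_star hl ho hn, ← hJ]
    rw [ht, show J ^ 3 * star J = J * star J * J ^ 2 by ring, map_mul f (J * star J), map_pow f J]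
  have hroot : t * (quartic J κ ^ 3 * quartic (star J) κ) = 1 := by
    rw [← quartic_pow_left hκo, ← quartic_mul_left]
    refine eq_of_dvd_sub_of_pow_five_eq_self hκ hκo ?_ (one_pow 5) ((hf _ _).1 hpJ)
    rw [pow_succ, mul_pow, ht4, quartic_mul_left, mul_pow, quartic_pow_left hκo, pow_right_comm,
      hJ4, hJ4', one_pow, one_mul, one_mul, one_mul]
  rw [quartic_natCast_of_norm_eq hκn]
  linear_combination (quartic J κ * star (quartic (star J) κ)) * -hroot +
    t * hJ4 + t * quartic J κ ^ 4 * mul_star_eq_one hJ4'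

theorem quartic_quarticJacobiSum_of_three_mod_four (hpq : p ≠ q) (h4 : q % 4 = 3) :
    quartic (quarticJacobiSum hl ho hn) q = quarticChar hl ho hn (-q) := by
  have hprime : Prime (q : ℤ[i]) := GaussianInt.prime_of_nat_prime_of_mod_four_eq_three q h4
  obtain ⟨R, _, _, f, ψ, hψ, hf⟩ := exists_primitive_addChar (p := p) hprime dvd_rfl hpq
  have hsum := pow_eq_quarticChar_neg_of_three_mod_four hl ho hn f hpq h4 hψ
  set J := quarticJacobiSum hl ho hn with hJ
  have hχ4 := quarticChar_apply_pow_four hl ho hn (neg_ne_zero.2 (natCast_zmod_ne_zero hpq))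
  have hpJ : (p : R) = f J ^ (q + 1) := by
    have hstar := (hf _ _).2 (dvd_pow_sub_star h4 J)
    rw [pow_succ', ← map_pow, hstar, ← map_mul, hJ, quarticJacobiSum_mul_star, map_natCast]
  have hp0 : (p : R) ≠ 0 := by
    rw [Ne, CharP.cast_eq_zero_iff R q, Nat.prime_dvd_prime_iff_eq hq.out hp.out]
    exact hpq.symm
  rw [quartic_prime hprime]
  refine quarticPrime_eq hprime ?_ (by rw [pow_succ, hχ4, one_mul]) ?_
  · exact_mod_cast odd_norm_intCast (n := q) (Int.odd_iff.2 (by omega))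
  · rw [← hf, norm_natCast_natAbs_div_four h4]
    apply mul_right_cancel₀ hp0
    rw [← hsum, hpJ, map_pow, ← pow_add, ← pow_add, ← pow_mul]
    congr 1
    obtain ⟨k, rfl⟩ : ∃ k, q = 4 * k + 3 := ⟨q / 4, by omega⟩
    rw [show (4 * k + 3 + 1) / 4 = k + 1 by omega, show 4 * k + 3 - 1 = 4 * k + 2 by omega]
    ring

end Reciprocity

end QuarticChar

/-! ### Primary numbers and quartic reciprocity -/

/-- A Gaussian integer is primary when it is congruent to `1` modulo `2`. (This is weaker than the
usual normalization modulo `2 + 2i`: it determines an odd number among its associates only up to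
sign, and signs are invisible in the moduli of quartic symbols.) -/
def IsPrimary (a : ℤ[i]) : Prop := Odd a.re ∧ Even a.im

namespace IsPrimary

variable {a b : ℤ[i]}

theorem odd_norm (ha : IsPrimary a) : Odd a.norm := by
  rw [gaussInt_norm_eq]
  exact ha.1.pow.add_even (ha.2.pow_of_ne_zero two_ne_zero)

theorem intCast {n : ℤ} (hn : Odd n) : IsPrimary n := ⟨by simpa using hn, by simp⟩

theorem of_mul_left (ha : IsPrimary a) (hab : IsPrimary (a * b)) : IsPrimary b := by
  have hre := Int.not_even_iff_odd.2 ha.1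
  simpa [IsPrimary, parity_simps, hre, ha.1, ha.2, Int.odd_mul] using hab

theorem eq_one_or_neg_one_of_isUnit (ha : IsPrimary a) (hu : IsUnit a) : a = 1 ∨ a = -1 := by
  have hnorm : a.re ^ 2 + a.im ^ 2 = 1 := by
    rw [← gaussInt_norm_eq]
    exact (Zsqrtd.norm_eq_one_iff' (by norm_num) a).2 hu
  have hre : 0 < a.re ^ 2 := even_two.pow_pos fun h => by simpa [h] using ha.1
  have him : a.im = 0 := pow_eq_zero_iff two_ne_zero |>.1 (by linarith [sq_nonneg a.im])
  rw [him, zero_pow two_ne_zero, add_zero, sq_eq_one_iff] at hnorm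
  rcases hnorm with h | h
  · exact Or.inl (Zsqrtd.ext h him)
  · exact Or.inr (Zsqrtd.ext h him)

theorem eq_or_eq_neg_of_associated (ha : IsPrimary a) (hb : IsPrimary b) (h : Associated a b) :
    b = a ∨ b = -a := by
  obtain ⟨u, rfl⟩ := h
  rcases (ha.of_mul_left hb).eq_one_or_neg_one_of_isUnit u.isUnit with h | h <;> rw [h]
  · exact Or.inl (mul_one a)
  · exact Or.inr (mul_neg_one a)

theorem exists_unit_mul (h : Odd a.norm) : ∃ u : ℤ[i]ˣ, IsPrimary (u * a) := by
  rw [gaussInt_norm_eq, Int.odd_add, ← Int.not_even_iff_odd] at h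
  simp only [Int.even_pow' two_ne_zero] at h
  rcases Int.even_or_odd a.im with him | him
  · exact ⟨1, by rw [Units.val_one, one_mul]; exact ⟨Int.not_even_iff_odd.1 (h.2 him), him⟩⟩
  · have hre : Even a.re := by_contra fun hre => Int.not_even_iff_odd.2 him (h.1 hre)
    have hi : (gaussIUnit : ℤ[i]) = ⟨0, 1⟩ := rfl
    exact ⟨gaussIUnit, by rw [hi]; constructor <;> simpa⟩

theorem induction {P : ℤ[i] → Prop} (one : P 1) (neg_one : P (-1))
    (prime_mul : ∀ l a, Prime l → IsPrimary l → IsPrimary a → P a → P (l * a)) {a : ℤ[i]}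
    (ha : IsPrimary a) : P a := by
  have hunit : ∀ e : ℤ[i]ˣ, IsPrimary (e * a) → P (e * a) := by
    have ho := ha.odd_norm
    clear ha
    induction a, ho using odd_norm_induction with
    | unit u _ hu =>
      intro e he
      rcases he.eq_one_or_neg_one_of_isUnit (e.isUnit.mul hu) with h | h <;> rw [h] <;> assumption
    | prime_mul l a ho _ hl ih =>
      intro e he
      obtain ⟨w, hw⟩ := exists_unit_mul ho
      have hsplit : (e : ℤ[i]) * (l * a) = (w * l) * ((e * w⁻¹ : ℤ[i]ˣ) * a) := by
        rw [Units.val_mul]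
        linear_combination (-(e * l * a : ℤ[i])) * w.mul_inv
      rw [hsplit] at he ⊢
      have ha := hw.of_mul_left he
      exact prime_mul _ _ ((associated_unit_mul_left l _ w.isUnit).symm.prime hl) hw ha (ih _ ha)
  simpa using hunit 1 (by simpa using ha)

end IsPrimary

theorem quartic_neg_left_intCast {n : ℤ} (hn : Odd n) (b : ℤ[i]) :
    quartic (-b) n = quartic b n := by
  simpa using quartic_intCast_mul hn (m := -1) isCoprime_one_left.neg_left b

theorem associated_quarticJacobiSum {l : ℤ[i]} {p : ℕ} [hp : Fact p.Prime] (hl : Prime l)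
    (ho : Odd l.norm) (hn : l.norm = p) : Associated l (quarticJacobiSum hl ho hn) := by
  have hnorm : (quarticJacobiSum hl ho hn).norm = p := by
    have h := quarticJacobiSum_mul_star hl ho hn
    rw [← Zsqrtd.norm_eq_mul_conj] at h
    exact_mod_cast h
  exact (hl.dvd_prime_iff_associated (prime_of_norm_prime hp.out hnorm)).1
    (dvd_quarticJacobiSum hl ho hn)

theorem quartic_reciprocity_of_norm_eq {l : ℤ[i]} (hl : Prime l) (hpl : IsPrimary l) {p q : ℕ}
    [Fact p.Prime] [Fact q.Prime] (hn : l.norm = p) (hpq : p ≠ q) (hq : Odd q) :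
    quartic (ZMod.χ₄ (q : ℤ) * q : ℤ) l = quartic l q := by
  have ho := hpl.odd_norm
  have hoq := (Int.odd_coe_nat q).2 hq
  have hJl : quartic (quarticJacobiSum hl ho hn) q = quartic l q := by
    have hprim : IsPrimary (quarticJacobiSum hl ho hn) := by
      obtain ⟨z, hz⟩ := exists_quarticJacobiSum_eq hl ho hn
      rw [hz]
      constructor <;> simp [parity_simps]
    rcases hpl.eq_or_eq_neg_of_associated hprim (associated_quarticJacobiSum hl ho hn) with h | h
    · rw [h]
    · rw [h]
      exact quartic_neg_left_intCast hoq l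
  rw [← hJl, quartic_prime hl, ← quarticChar_intCast hl ho hn]
  rcases χ₄_eq_or hoq with ⟨h, h4⟩ | ⟨h, h4⟩ <;> rw [h]
  · rw [quartic_quarticJacobiSum_of_one_mod_four hl ho hn hpq (by omega)]
    simp
  · rw [quartic_quarticJacobiSum_of_three_mod_four hl ho hn hpq (by omega)]
    simp

theorem quartic_reciprocity_natPrime {l : ℤ[i]} (hl : Prime l) (hpl : IsPrimary l) {q : ℕ}
    [hq : Fact q.Prime] (ho : Odd q) :
    quartic (ZMod.χ₄ (q : ℤ) * q : ℤ) l = quartic l (q : ℤ) := by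
  have hoq := (Int.odd_coe_nat q).2 ho
  obtain ⟨p, hp, ⟨-, hn⟩ | ⟨h4, hassoc⟩⟩ := norm_eq_or_associated_of_prime hl hpl.odd_norm
  · by_cases hpq : p = q
    · have hlq : ((q : ℤ) : ℤ[i]) = l * star l := by
        rw [Int.cast_natCast, natCast_eq_mul_star (hpq ▸ hn)]
      have hll : quartic l l = 0 := (quartic_prime hl l).trans (quarticPrime_of_dvd hl dvd_rfl)
      rw [Int.cast_mul, hlq, quartic_mul_left, quartic_mul_left,
        quartic_mul_right, hll, zero_mul, zero_mul, mul_zero]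
    · have : Fact p.Prime := ⟨hp⟩
      rw [quartic_reciprocity_of_norm_eq hl hpl hn hpq ho, Int.cast_natCast]
  · have hop : Odd (p : ℤ) := Int.odd_iff.2 (by omega)
    have hcop : p = q ∨ IsCoprime (p : ℤ) q := by
      rw [Nat.isCoprime_iff_coprime, Nat.coprime_primes hp hq.out]
      exact eq_or_ne p q
    have hpq : quartic (ZMod.χ₄ (q : ℤ) * q : ℤ) (p : ℤ) = quartic (p : ℤ) (q : ℤ) := by
      have hneg : quartic (ZMod.χ₄ (q : ℤ) * q : ℤ) (p : ℤ) = quartic (q : ℤ) (p : ℤ) := by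
        rcases χ₄_eq_or hoq with ⟨h, -⟩ | ⟨h, -⟩ <;> rw [h]
        · rw [one_mul]
        · rw [neg_one_mul, Int.cast_neg, quartic_neg_left_intCast hop]
      rw [hneg]
      rcases hcop with rfl | h
      · rfl
      · rw [quartic_intCast_intCast hop h.symm, quartic_intCast_intCast hoq h]
    rcases (IsPrimary.intCast hop).eq_or_eq_neg_of_associated hpl hassoc.symm with rfl | rfl
    · exact hpq
    · rw [quartic_neg_right, hpq]
      exact (quartic_neg_left_intCast hoq _).symm

theorem quartic_reciprocity {a : ℤ[i]} (ha : IsPrimary a) {n : ℤ} (hn : Odd n) :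
    quartic (ZMod.χ₄ n * n : ℤ) a = quartic a n := by
  refine IsPrimary.induction (P := fun a => quartic (ZMod.χ₄ n * n : ℤ) a = quartic a n)
    ?_ ?_ (fun l a hl hpl _ ih => ?_) ha
  · rw [quartic_of_isUnit isUnit_one, quartic_one_left (odd_norm_intCast hn)]
  · rw [quartic_of_isUnit isUnit_one.neg, quartic_neg_left_intCast hn,
      quartic_one_left (odd_norm_intCast hn)]
  · rw [quartic_mul_right, ih, quartic_mul_left]
    congr 1
    clear ih
    induction n, hn using odd_int_induction with
    | one =>
      rw [quartic_of_isUnit (a := (1 : ℤ)) (by simp)]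
      simpa using quartic_one_left hpl.odd_norm
    | neg n hn h => rw [χ₄_neg_mul_neg, h, Int.cast_neg, quartic_neg_right]
    | prime_mul q n ho _ hq h =>
      have : Fact q.Prime := ⟨hq⟩
      rw [Int.cast_mul (q : ℤ) n, map_mul, mul_mul_mul_comm, Int.cast_mul, quartic_mul_left, h,
        quartic_reciprocity_natPrime hl hpl ho, Int.cast_mul, quartic_mul_right]

theorem quartic_reciprocity_sq {a : ℤ[i]} (ha : IsPrimary a) {n : ℤ} (hn : Odd n) :
    quartic n a ^ 2 = quartic a n ^ 2 := by
  rw [← quartic_reciprocity ha hn, Int.cast_mul, quartic_mul_left, mul_pow,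
    ← quartic_pow_left ha.odd_norm (ZMod.χ₄ n : ℤ), ← Int.cast_pow, χ₄_sq hn, Int.cast_one,
    quartic_one_left ha.odd_norm, one_mul]

theorem quartic_gaussI_intCast {n : ℤ} (hn : Odd n) : quartic gaussI n = iPow (n ^ 2 / 4) := by
  rw [quartic_gaussI (odd_norm_intCast hn), Zsqrtd.norm_intCast, pow_two]

theorem neg_two_mul_sub_two_mul_sub_modEq {u v n : ℤ} (hu : Odd u) (hv : Even v)
    (hn : (u + v) ^ 2 = n ^ 2) (h4 : n % 4 = 1) :
    -(n / 4) * 2 - u ^ 2 / 4 * 2 - (u ^ 2 + v ^ 2) / 4 ≡ u * v / 2 [ZMOD 4] := by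
  obtain ⟨w, rfl⟩ := hv.two_dvd
  obtain ⟨k, rfl⟩ : ∃ k, n = 4 * k + 1 := ⟨n / 4, by omega⟩
  obtain ⟨m, hm⟩ := Int.eight_dvd_sq_sub_one_of_odd hu
  have hk : (4 * k + 1) / 4 = k := by omega
  have huv : u * (2 * w) / 2 = u * w := by
    rw [mul_left_comm, Int.mul_ediv_cancel_left _ two_ne_zero]
  have hsq : (u ^ 2 + (2 * w) ^ 2) / 4 = 4 * k ^ 2 + 2 * k - u * w := by
    ring_nf at hn ⊢
    omega
  rw [hk, huv, hsq]
  exact Int.modEq_iff_dvd.2 ⟨k ^ 2 + k + m, by ring_nf; omega⟩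

theorem quartic_two_of_isCoprime {a : ℤ[i]} (ha : IsPrimary a) (h : IsCoprime a.re a.im) :
    quartic 2 a = iPow (a.re * a.im / 2) := by
  have hsum : Odd (a.re + a.im) := ha.1.add_even ha.2
  have hmod_re : quartic a a.re = iPow (a.re ^ 2 / 4) := by
    rw [quartic_congr (b' := a.im * gaussI) ⟨1, by
      linear_combination gaussInt_eq_re_add_im_mul a⟩,
      quartic_intCast_mul ha.1 h.symm, quartic_gaussI_intCast ha.1]
  have hmod_sum : quartic a (a.re + a.im : ℤ) =
      iPow (-(ZMod.χ₄ (a.re + a.im : ℤ) * (a.re + a.im) / 4)) := by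
    have hcop : IsCoprime a.re (a.re + a.im) := by simpa using h.mul_add_left_right 1
    rw [quartic_congr (b' := a.re * (1 - gaussI)) ⟨gaussI, by
      push_cast; linear_combination gaussInt_eq_re_add_im_mul a⟩,
      quartic_intCast_mul hsum hcop, quartic_one_sub_gaussI hsum]
  have hdvd : quartic (a.re + a.im : ℤ) a ^ 2 =
      quartic a.re a ^ 2 * (quartic 2 a * quartic gaussI a) := by
    rw [← quartic_mul_left, ← quartic_pow_left ha.odd_norm, ← quartic_pow_left ha.odd_norm,
      ← quartic_mul_left]
    refine quartic_congr ⟨-gaussI * (a.re * (1 + gaussI) + (a.re + a.im)), ?_⟩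
    push_cast
    linear_combination gaussI * (a.re * (1 + gaussI) + (a.re + a.im)) * gaussInt_eq_re_add_im_mul a
      + (a.re ^ 2 + a.im * (a.re * (1 + gaussI) + (a.re + a.im))) * gaussI_sq
  rw [quartic_reciprocity_sq ha hsum, quartic_reciprocity_sq ha ha.1, hmod_re, hmod_sum,
    quartic_gaussI ha.odd_norm, iPow_pow, iPow_pow, eq_comm, iPow_mul_eq_iff, mul_comm,
    iPow_mul_eq_iff, ← iPow_add, ← iPow_add, gaussInt_norm_eq] at hdvd
  rw [hdvd]
  refine iPow_congr (Eq.trans (congrArg (· % 4) ?_) (neg_two_mul_sub_two_mul_sub_modEq ha.1 ha.2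
    (by rw [mul_pow, χ₄_sq hsum, one_mul]) (χ₄_mul_self_emod_four hsum)))
  push_cast
  ring

theorem quartic_two {a : ℤ[i]} (ha : IsPrimary a) : quartic 2 a = iPow (a.re * a.im / 2) := by
  have hgcd : 0 < Int.gcd a.re a.im := Int.gcd_pos_of_ne_zero_left _ (by
    intro h; simpa [h] using ha.1)
  obtain ⟨u, v, huv, hu, hv⟩ := Int.exists_gcd_one hgcd
  set g : ℤ := (Int.gcd a.re a.im : ℤ)
  have hg : Odd g := (Int.odd_mul.1 (hu ▸ ha.1)).2
  have hsplit : a = g * ⟨u, v⟩ := by ext <;> simp [hu, hv, mul_comm]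
  have hprim := (IsPrimary.intCast hg).of_mul_left (hsplit ▸ ha)
  have hg2 : quartic 2 g = 1 := by
    simpa using quartic_intCast_intCast hg (Int.isCoprime_two_left.2 hg)
  rw [hsplit, quartic_mul_right, hg2, one_mul,
    quartic_two_of_isCoprime hprim (Int.isCoprime_iff_gcd_eq_one.2 huv), ← hsplit, hu, hv]
  dsimp only at hprim ⊢
  obtain ⟨w, rfl⟩ : 2 ∣ v := hprim.2.two_dvd
  obtain ⟨m, hm⟩ := Int.eight_dvd_sq_sub_one_of_odd hg
  rw [show u * (2 * w) = 2 * (u * w) by ring, Int.mul_ediv_cancel_left _ two_ne_zero,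
    show u * g * (2 * w * g) = 2 * (u * w * g ^ 2) by ring, Int.mul_ediv_cancel_left _ two_ne_zero]
  exact iPow_congr (Int.modEq_iff_dvd.2 ⟨2 * m * (u * w), by linear_combination u * w * hm⟩)

/-! ### The descent -/

theorem exists_common_square_factor {q w b n Y : ℤ} (hn : n ≠ 0) (h : b ^ 2 + q * Y ^ 2 = w * n)
    (hcop : ∀ r, Prime r → r ∣ b → r ∣ n → ¬ r ∣ q * w) :
    ∃ g b₁ n₁ Y₁ : ℤ, b = g * b₁ ∧ n = g ^ 2 * n₁ ∧ Y = g * Y₁ ∧ IsCoprime b₁ n₁ := by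
  set g := gcd (gcd b Y) n with hg
  have hgb : g ∣ b := (gcd_dvd_left _ _).trans (gcd_dvd_left _ _)
  have hgY : g ∣ Y := (gcd_dvd_left _ _).trans (gcd_dvd_right _ _)
  have hgn : g ∣ n := gcd_dvd_right _ _
  have hg0 : g ≠ 0 := ne_zero_of_dvd_ne_zero hn hgn
  have hgw : IsCoprime g w := isCoprime_of_prime_dvd (fun h0 => hg0 h0.1) fun r hr hrg hrw =>
    hcop r hr (hrg.trans hgb) (hrg.trans hgn) (hrw.mul_left q)
  obtain ⟨b₁, hb₁⟩ := hgb
  obtain ⟨Y₁, hY₁⟩ := hgY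
  obtain ⟨m, hm⟩ := hgn
  have hquot : g * (b₁ ^ 2 + q * Y₁ ^ 2) = w * m := by
    refine mul_left_cancel₀ hg0 ?_
    rw [hb₁, hY₁, hm] at h
    linear_combination h
  obtain ⟨n₁, rfl⟩ := hgw.dvd_of_dvd_mul_left ⟨_, hquot.symm⟩
  refine ⟨g, b₁, n₁, Y₁, hb₁, by rw [hm]; ring, hY₁, isCoprime_of_prime_dvd
    (fun h0 => hn (by rw [hm, h0.2, mul_zero, mul_zero])) fun r hr hrb hrn => ?_⟩
  have hrb' : r ∣ b := hb₁ ▸ hrb.mul_left g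
  have hrn' : r ∣ n := hm ▸ (hrn.mul_left g).mul_left g
  have hred : q * Y₁ ^ 2 = w * n₁ - b₁ ^ 2 := by
    refine mul_left_cancel₀ hg0 ?_
    linear_combination hquot
  have hrY : r ∣ Y₁ := by
    have hdvd : r ∣ q * Y₁ ^ 2 := hred ▸ dvd_sub (hrn.mul_left w) (dvd_pow hrb two_ne_zero)
    exact hr.dvd_of_dvd_pow
      ((hr.dvd_or_dvd hdvd).resolve_left fun hrq => hcop r hr hrb' hrn' (hrq.mul_right w))
  have hrg : g * r ∣ g * 1 := by
    rw [mul_one]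
    nth_rw 2 [hg]
    refine dvd_gcd (dvd_gcd ?_ ?_) ?_
    · exact hb₁ ▸ mul_dvd_mul_left g hrb
    · exact hY₁ ▸ mul_dvd_mul_left g hrY
    · exact hm ▸ mul_dvd_mul_left g (hrn.mul_left g)
  exact hr.not_isUnit (isUnit_of_dvd_one ((mul_dvd_mul_iff_left hg0).1 hrg))

theorem quartic_flip_of_dvd {B : ℤ[i]} (hB : IsPrimary B) {n X q y : ℤ} {k : ℕ} (hn : Odd n)
    (hX : Odd X) (hq : q % 4 = 1) (hy : Odd y)
    (h : B ∣ (2 * n * X : ℤ) - (q * (2 ^ k * y) ^ 2 : ℤ)) :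
    quartic (ZMod.χ₄ n * ZMod.χ₄ X : ℤ) B * (quartic 2 B * quartic B n * quartic B X) =
      quartic B q * quartic 2 B ^ (2 * k) * quartic B y ^ 2 := by
  have hqB : quartic q B = quartic B q := by
    have := quartic_reciprocity hB (Int.odd_iff.2 (by omega : q % 2 = 1))
    rwa [ZMod.χ₄_int_one_mod_four hq, one_mul] at this
  have hcongr := quartic_congr h
  simp only [Int.cast_mul, Int.cast_pow, Int.cast_ofNat, quartic_mul_left,
    quartic_pow_left hB.odd_norm, mul_pow, quartic_reciprocity_sq hB hy, hqB, ← pow_mul,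
    mul_comm k 2] at hcongr
  rw [← quartic_reciprocity hB hn, ← quartic_reciprocity hB hX, mul_assoc (quartic B q), ← hcongr]
  simp only [Int.cast_mul, quartic_mul_left]
  have hχ : ∀ {m : ℤ}, Odd m → quartic (ZMod.χ₄ m : ℤ) B ^ 2 = 1 := fun hm => by
    rw [← quartic_pow_left hB.odd_norm, ← Int.cast_pow, χ₄_sq hm, Int.cast_one,
      quartic_one_left hB.odd_norm]
  linear_combination (quartic 2 B * quartic n B * quartic X B) *
    (quartic (ZMod.χ₄ X : ℤ) B ^ 2 * hχ hn + hχ hX)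

theorem quartic_descent_of_isCoprime {ρ ρ' B : ℤ[i]} (hB : IsPrimary B) {g n b X q y : ℤ} {k : ℕ}
    (hn : Odd n) (hX : Odd X) (hq : q % 4 = 1) (hy : Odd y) (hA : (⟨g * n, b⟩ : ℤ[i]) = ρ * B)
    (hgA : g * (ρ * B) = X + ρ')
    (hN : (ρ * B).norm = 2 * n * X - q * (2 ^ k * y) ^ 2)
    (hsq : (ρ * B) ^ 2 = 2 * n * ρ' + q * (2 ^ k * y) ^ 2)
    (hbn : IsCoprime b n) (hgX : IsCoprime g X) (hgq : IsCoprime g q) :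
    quartic (ZMod.χ₄ n * ZMod.χ₄ X : ℤ) B *
        (quartic gaussI n * quartic ρ' X * quartic 2 B * quartic ρ q * quartic ρ y ^ 2) =
      quartic (X + ρ') q * quartic 2 B ^ (2 * k) * quartic ρ' y * quartic ρ X * quartic ρ n := by
  have hqo : Odd q := Int.odd_iff.2 (by omega)
  have hny : IsCoprime n y := isCoprime_of_prime_dvd (fun h0 => by simp [h0.1] at hn)
    fun r hr hrn hry => by
      have hb : b ^ 2 = 2 * n * X - q * (2 ^ k * y) ^ 2 - (g * n) ^ 2 := by
        rw [← hN, ← hA, gaussInt_norm_eq]; ring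
      have hrb : r ∣ b ^ 2 := hb ▸ dvd_sub (dvd_sub ((hrn.mul_left 2).mul_right X)
        ((dvd_pow (hry.mul_left _) two_ne_zero).mul_left q)) (dvd_pow (hrn.mul_left g) two_ne_zero)
      exact hr.not_isUnit (hbn.isUnit_of_dvd' (hr.dvd_of_dvd_pow hrb) hrn)
  have hAn : quartic (ρ * B) n = quartic gaussI n := by
    rw [quartic_congr (b' := b * gaussI) ⟨g, by
      rw [← hA, gaussI]; ext <;> simp [mul_comm]⟩,
      quartic_intCast_mul hn hbn]
  have hAX : quartic (ρ * B) X = quartic ρ' X := by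
    rw [← quartic_intCast_mul hX hgX, hgA]
    exact quartic_congr ⟨1, by ring⟩
  have hAq : quartic (ρ * B) q = quartic (X + ρ') q := by
    rw [← hgA, quartic_intCast_mul hqo hgq]
  have hAy : quartic (ρ * B) y ^ 2 = quartic ρ' y := by
    have h2n : IsCoprime (2 * n) y := (Int.isCoprime_two_left.2 hy).mul_left hny
    rw [← quartic_pow_left (odd_norm_intCast hy), ← quartic_intCast_mul hy h2n ρ']
    exact quartic_congr ⟨q * (2 ^ k) ^ 2 * y, by push_cast; linear_combination hsq⟩
  have hflip := quartic_flip_of_dvd (k := k) hB hn hX hq hy ⟨ρ * star (ρ * B), by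
    rw [← Int.cast_sub, ← hN, Zsqrtd.norm_eq_mul_conj]; ring⟩
  rw [← hAn, ← hAX, ← hAq, ← hAy]
  simp only [quartic_mul_left]
  linear_combination (quartic ρ n * quartic ρ X * quartic ρ q * quartic ρ y ^ 2) * hflip

theorem exists_square_factor_of_norm_eq {X a b q Y : ℤ} (hn : Odd (X + a)) (hX : Odd X)
    (hnorm : a ^ 2 + b ^ 2 = X ^ 2 - q * Y ^ 2)
    (hab : ∀ r, Prime r → Odd r → r ∣ a → ¬ r ∣ b)
    (hqb : ∀ r, Prime r → r ∣ q → r ∣ X + a → ¬ r ∣ b) :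
    ∃ g b₁ n₁ Y₁ : ℤ, b = g * b₁ ∧ X + a = g ^ 2 * n₁ ∧ Y = g * Y₁ ∧ IsCoprime b₁ n₁ ∧
      IsCoprime g a ∧ IsCoprime g X ∧ IsCoprime g q := by
  have hodd : ∀ {r m : ℤ}, Odd m → r ∣ m → Odd r := fun hm ⟨s, hs⟩ => (Int.odd_mul.1 (hs ▸ hm)).1
  obtain ⟨g, b₁, n₁, Y₁, rfl, hgn, hgY, hcop⟩ := exists_common_square_factor (n := X + a) (q := q)
    (w := X - a) (b := b) (Y := Y) (fun h0 => by simp [h0] at hn)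
    (by linear_combination hnorm) (fun r hr hrb hrn hrqw => by
      rcases hr.dvd_or_dvd hrqw with hrq | hrw
      · exact hqb r hr hrq hrn hrb
      · have hra : r ∣ 2 * a := by simpa [two_mul] using dvd_sub hrn hrw
        refine hab r hr (hodd hn hrn) ((hr.dvd_or_dvd hra).resolve_left fun hr2 => ?_) hrb
        exact hr.not_isUnit ((Int.isCoprime_two_left.2 hn).isUnit_of_dvd' hr2 hrn))
  have hgn' : g ∣ X + a := hgn ▸ (dvd_pow_self g two_ne_zero).mul_right n₁
  have hcop_of : ∀ m, (∀ r, Prime r → r ∣ m → r ∣ X + a → ¬ r ∣ g * b₁) → IsCoprime g m :=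
    fun m h => isCoprime_of_prime_dvd (fun h0 => by simp [hgn, h0.1] at hn)
      fun r hr hrg hrm => h r hr hrm (hrg.trans hgn') (hrg.mul_right b₁)
  exact ⟨g, b₁, n₁, Y₁, rfl, hgn, hgY, hcop,
    hcop_of a fun r hr hra hrn => hab r hr (hodd hn hrn) hra,
    hcop_of X fun r hr hrX hrn => hab r hr (hodd hX hrX) ((dvd_add_right hrX).1 hrn),
    hcop_of q hqb⟩

theorem quartic_gaussI_sq_mul {g : ℤ} (hg : Odd g) (n : ℤ) :
    quartic gaussI (g ^ 2 * n : ℤ) = quartic gaussI n := by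
  rw [Int.cast_mul, Int.cast_pow, quartic_mul_right, pow_two, quartic_mul_right, ← pow_two,
    ← quartic_pow_left (odd_norm_intCast hg), gaussI_sq, quartic_neg_left_intCast hg,
    quartic_one_left (odd_norm_intCast hg), one_mul]

theorem quartic_descent_mul {ρ B : ℤ[i]} {X a b g n q y : ℤ} {k : ℕ} (hB : IsPrimary B)
    (hg : Odd g) (hgn : X + a = g ^ 2 * n) (hn : Odd n) (hX : Odd X) (hq : q % 4 = 1) (hy : Odd y)
    (hnorm : a ^ 2 + (g * b) ^ 2 = X ^ 2 - q * (2 ^ k * (g * y)) ^ 2)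
    (hA : (⟨g * n, b⟩ : ℤ[i]) = ρ * B) (hbn : IsCoprime b n) (hga : IsCoprime g a)
    (hgX : IsCoprime g X) (hgq : IsCoprime g q) :
    quartic (ZMod.χ₄ (X + a : ℤ) * ZMod.χ₄ X : ℤ) (g * B) *
        (quartic gaussI (X + a : ℤ) * quartic ⟨a, g * b⟩ X * quartic 2 (g * B) * quartic ρ q *
          quartic ρ (g * y : ℤ) ^ 2) =
      quartic ⟨X + a, g * b⟩ q * quartic 2 (g * B) ^ (2 * k) * quartic ⟨a, g * b⟩ (g * y : ℤ) *
        quartic ρ X * quartic ρ (X + a : ℤ) := by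
  have hg0 : g ≠ 0 := fun h0 => by simp [h0] at hg
  have hkey : (g * n) ^ 2 + b ^ 2 = 2 * n * X - q * (2 ^ k * y) ^ 2 := by
    refine mul_left_cancel₀ (pow_ne_zero 2 hg0) ?_
    linear_combination hnorm - (g ^ 2 * n - X + a) * hgn
  have hsq : (⟨g * n, b⟩ : ℤ[i]) ^ 2 =
      (2 * n : ℤ) * ⟨a, g * b⟩ + (q * (2 ^ k * y) ^ 2 : ℤ) := by
    rw [pow_two]
    ext
    · simp only [Zsqrtd.re_mul, Zsqrtd.re_add, Zsqrtd.re_intCast, Zsqrtd.im_intCast]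
      linear_combination -hkey - 2 * n * hgn
    · simp only [Zsqrtd.im_mul, Zsqrtd.im_add, Zsqrtd.re_intCast, Zsqrtd.im_intCast]
      ring
  have hα : (⟨X + a, g * b⟩ : ℤ[i]) = X + ⟨a, g * b⟩ := by ext <;> simp
  have hred := quartic_descent_of_isCoprime (ρ' := ⟨a, g * b⟩) hB hn hX hq hy hA
    (by rw [← hA, ← hα, Zsqrtd.smul_val, ← mul_assoc, ← pow_two, hgn])
    (by rw [← hA, gaussInt_norm_eq, ← hkey])
    (by rw [← hA]; exact_mod_cast hsq) hbn hgX hgq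
  have hχ : ZMod.χ₄ (g ^ 2 * n : ℤ) = ZMod.χ₄ n := by
    rw [Int.cast_mul, Int.cast_pow, map_mul, map_pow, χ₄_sq hg, one_mul]
  have hgB : ∀ m : ℤ, IsCoprime m g → quartic m (g * B) = quartic m B := fun m hm => by
    rw [quartic_mul_right, quartic_intCast_intCast hg hm, one_mul]
  have hχg : IsCoprime (ZMod.χ₄ n * ZMod.χ₄ X) g := isCoprime_one_left.of_isCoprime_of_dvd_left
    (IsUnit.of_pow_eq_one (n := 2) (by rw [mul_pow, χ₄_sq hn, χ₄_sq hX, one_mul])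
      two_ne_zero).dvd
  have h2g : quartic 2 (g * B) = quartic 2 B := by
    simpa using hgB 2 (Int.isCoprime_two_left.2 hg)
  have hag : quartic ⟨a, g * b⟩ g = 1 := by
    rw [← quartic_intCast_intCast hg hga.symm]
    exact quartic_congr ⟨b * gaussI, by rw [gaussI]; ext <;> simp⟩
  rw [hα, hgn, hχ, quartic_gaussI_sq_mul hg, hgB _ hχg, h2g]
  simp only [Int.cast_mul g, Int.cast_mul (g ^ 2), Int.cast_pow g, quartic_mul_right, hag,
    pow_two (g : ℤ[i])]
  linear_combination quartic ρ g ^ 2 * hred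

theorem quartic_descent {ρ β : ℤ[i]} (hρ : ρ ∣ 2) (hβ : IsPrimary β) {X a b q y : ℤ} {k : ℕ}
    (hn : Odd (X + a)) (hX : Odd X) (hq : q % 4 = 1) (hy : Odd y)
    (hnorm : a ^ 2 + b ^ 2 = X ^ 2 - q * (2 ^ k * y) ^ 2) (hα : (⟨X + a, b⟩ : ℤ[i]) = ρ * β)
    (hab : ∀ r, Prime r → Odd r → r ∣ a → ¬ r ∣ b)
    (hqb : ∀ r, Prime r → r ∣ q → r ∣ X + a → ¬ r ∣ b) :
    quartic (ZMod.χ₄ (X + a : ℤ) * ZMod.χ₄ X : ℤ) β *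
        (quartic gaussI (X + a : ℤ) * quartic ⟨a, b⟩ X * quartic 2 β * quartic ρ q *
          quartic ρ y ^ 2) =
      quartic ⟨X + a, b⟩ q * quartic 2 β ^ (2 * k) * quartic ⟨a, b⟩ y * quartic ρ X *
        quartic ρ (X + a : ℤ) := by
  obtain ⟨g, b₁, n, Y, rfl, hgn, hgY, hbn, hga, hgX, hgq⟩ :=
    exists_square_factor_of_norm_eq hn hX hnorm hab hqb
  obtain ⟨hgo, hno⟩ : Odd g ∧ Odd n := by
    rw [hgn, Int.odd_mul, Int.odd_pow' two_ne_zero] at hn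
    exact hn
  obtain ⟨y, rfl⟩ : g ∣ y :=
    (Int.isCoprime_two_right.2 hgo).pow_right.dvd_of_dvd_mul_left ⟨Y, hgY⟩
  have hαg : (⟨X + a, g * b₁⟩ : ℤ[i]) = g * ⟨g * n, b₁⟩ := by
    rw [Zsqrtd.smul_val, ← mul_assoc, ← pow_two, hgn]
  have hgρ : IsCoprime (g : ℤ[i]) ρ :=
    (isCoprime_two_of_odd_norm (odd_norm_intCast hgo)).symm.of_isCoprime_of_dvd_right hρ
  obtain ⟨B, rfl⟩ : (g : ℤ[i]) ∣ β := hgρ.dvd_of_dvd_mul_left ⟨_, hα ▸ hαg⟩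
  have hg0 : (g : ℤ[i]) ≠ 0 := ne_zero_of_odd_norm (odd_norm_intCast hgo)
  have hA : (⟨g * n, b₁⟩ : ℤ[i]) = ρ * B :=
    mul_left_cancel₀ hg0 (by rw [← hαg, hα]; ring)
  exact quartic_descent_mul ((IsPrimary.intCast hgo).of_mul_left hβ) hgo hgn hno hX hq
    (Int.odd_mul.1 hy).2 hnorm hA hbn hga hgX hgq

/-! ### Evaluation of the symbol for `4p = x² + 11y²` -/

theorem quartic_χ₄ {a : ℤ[i]} (ha : Odd a.norm) {n : ℤ} (hn : Odd n) :
    quartic (ZMod.χ₄ n : ℤ) a = iPow ((n - 1) * (a.norm / 4)) := by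
  rcases χ₄_eq_or hn with ⟨h, h4⟩ | ⟨h, h4⟩
  · rw [h, Int.cast_one, quartic_one_left ha, ← iPow_zero]
    exact iPow_congr ((Int.modEq_zero_iff_dvd.2 (Dvd.dvd.mul_right (by omega) _)).symm)
  · have ha4 := norm_emod_four_of_odd ha
    obtain ⟨m, rfl⟩ : ∃ m, n = 4 * m + 3 := ⟨n / 4, by omega⟩
    rw [h, Int.cast_neg, Int.cast_one, quartic_neg_one ha,
      (by ring : (4 * m + 3 - 1) * (a.norm / 4) = 2 * (a.norm / 4) + 4 * (m * (a.norm / 4)))]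
    exact iPow_congr (by rw [Int.modEq_iff_dvd]; omega)

theorem quartic_comm {a : ℤ[i]} (ha : IsPrimary a) {n : ℤ} (hn : Odd n) :
    quartic a n = iPow ((n - 1) * (a.norm / 4)) * quartic n a := by
  rw [← quartic_reciprocity ha hn, Int.cast_mul, quartic_mul_left, quartic_χ₄ ha.odd_norm hn]

theorem quartic_comm_of_emod_four_eq_one {a : ℤ[i]} (ha : IsPrimary a) {n : ℤ} (hn : n % 4 = 1) :
    quartic a n = quartic n a := by
  have h : iPow ((n - 1) * (a.norm / 4)) = iPow 0 :=
    iPow_congr (Int.modEq_zero_iff_dvd.2 ((by omega : (4 : ℤ) ∣ n - 1).mul_right _))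
  rw [quartic_comm ha (Int.odd_iff.2 (by omega)), h, iPow_zero, one_mul]

theorem quartic_χ₄_mul_χ₄ {a : ℤ[i]} (ha : Odd a.norm) {m n : ℤ} (hm : Odd m) (hn : Odd n) :
    quartic (ZMod.χ₄ m * ZMod.χ₄ n : ℤ) a = iPow ((m + n - 2) * (a.norm / 4)) := by
  rw [Int.cast_mul, quartic_mul_left, quartic_χ₄ ha hm, quartic_χ₄ ha hn, ← iPow_add]
  ring_nf

theorem quartic_one_sub_mul_gaussI {ν m : ℤ} (hν : ν = 1 ∨ ν = -1) (hm : Odd m) :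
    quartic ⟨1, -ν⟩ m = iPow (-ν * (ZMod.χ₄ m * m / 4)) := by
  rcases hν with rfl | rfl
  · rw [neg_one_mul, ← quartic_one_sub_gaussI hm]
    rfl
  · rw [neg_neg, one_mul, ← quartic_one_add_gaussI hm]
    rfl

theorem int_prime_eleven : Prime (11 : ℤ) := Int.prime_iff_natAbs_prime.2 (by norm_num)

theorem odd_exponent_modEq {c d x : ℤ} (hc : c % 4 = 1) (hd : Even d) (hx : Odd x) :
    -((x + 2 * c + x - 2) * (((x + 2 * c) ^ 2 + (2 * d) ^ 2) / 4) + (x + 2 * c) ^ 2 / 4 +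
        (x - 1) * ((c ^ 2 + d ^ 2) / 4) + (x + 2 * c) * (2 * d) / 2) ≡
      2 * ((x ^ 2 - 1) / 8 + (x + 1) / 2 * ((c ^ 2 + d ^ 2) / 4 + 1)) [ZMOD 4] := by
  obtain ⟨b, rfl⟩ : ∃ b, c = 4 * b + 1 := ⟨c / 4, by omega⟩
  obtain ⟨δ, rfl⟩ := hd.two_dvd
  obtain ⟨l, rfl⟩ := hx
  obtain ⟨s, hs⟩ := (Int.even_mul_succ_self l).two_dvd
  obtain ⟨w, hw⟩ := (Int.even_mul_succ_self δ).two_dvd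
  set T := s + l * (4 * b + 1) + 8 * b ^ 2 + 6 * b + 1 with hT
  set P := 4 * b ^ 2 + 2 * b + δ ^ 2 with hP
  have hm : (2 * l + 1 + 2 * (4 * b + 1)) ^ 2 = 8 * T + 1 := by
    linear_combination 4 * hs
  have hN : ((2 * l + 1 + 2 * (4 * b + 1)) ^ 2 + (2 * (2 * δ)) ^ 2) / 4 = 2 * T + 4 * δ ^ 2 := by
    rw [(by linear_combination hm : (2 * l + 1 + 2 * (4 * b + 1)) ^ 2 + (2 * (2 * δ)) ^ 2 =
      4 * (2 * T + 4 * δ ^ 2) + 1)]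
    omega
  have hp : ((4 * b + 1) ^ 2 + (2 * δ) ^ 2) / 4 = P := by
    rw [(by ring : (4 * b + 1) ^ 2 + (2 * δ) ^ 2 = 4 * P + 1)]
    omega
  have hx : ((2 * l + 1) ^ 2 - 1) / 8 = s := by
    rw [(by linear_combination 4 * hs : (2 * l + 1) ^ 2 - 1 = 8 * s)]
    omega
  have hmd : (2 * l + 1 + 2 * (4 * b + 1)) * (2 * (2 * δ)) / 2 = 2 * (2 * l + 8 * b + 3) * δ := by
    rw [(by ring : (2 * l + 1 + 2 * (4 * b + 1)) * (2 * (2 * δ)) =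
      2 * (2 * (2 * l + 8 * b + 3) * δ))]
    omega
  rw [hN, hm, hp, hx, hmd, (by omega : (8 * T + 1) / 4 = 2 * T),
    (by omega : (2 * l + 1 + 1) / 2 = l + 1), Int.modEq_iff_dvd]
  refine ⟨s + 2 * l * b + l + 6 * b ^ 2 + 4 * b + 1 + l * P + (l + 4 * b + 1) * δ + w +
    (2 * l + 4 * b + 1) * (T + 2 * δ ^ 2), ?_⟩
  linear_combination 2 * hT + 2 * hP + 2 * hw

theorem not_dvd_im_of_not_eleven_dvd {a b r : ℤ} (h : ¬ ((11 : ℤ) : ℤ[i]) ∣ ⟨a, b⟩)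
    (hr : Prime r) (h11 : r ∣ -11) (ha : r ∣ a) : ¬ r ∣ b := fun hb =>
  have hd : 11 ∣ r :=
    (hr.associated_of_dvd int_prime_eleven (dvd_neg.1 h11)).symm.dvd
  h ((Zsqrtd.intCast_dvd _ _).2 ⟨hd.trans ha, hd.trans hb⟩)

theorem quartic_two_mul_intCast {n : ℤ} (hn : Odd n) (a b : ℤ) :
    quartic ⟨2 * a, 2 * b⟩ n = quartic ⟨a, b⟩ n := by
  rw [← quartic_intCast_mul hn (Int.isCoprime_two_left.2 hn) ⟨a, b⟩]
  congr 1
  ext <;> simp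

theorem quartic_of_odd {c d x y : ℤ} (hcd : IsCoprime c d) (hc : c % 4 = 1) (hd : Even d)
    (hxy : 4 * (c ^ 2 + d ^ 2) = x ^ 2 + 11 * y ^ 2) (hx : Odd x) (hy : y % 4 = 1)
    (h11 : ¬ ((11 : ℤ) : ℤ[i]) ∣ ⟨x + 2 * c, 2 * d⟩) :
    quartic x ⟨c, d⟩ = iPow (2 * ((x ^ 2 - 1) / 8 + (x + 1) / 2 * ((c ^ 2 + d ^ 2) / 4 + 1))) *
      (quartic ⟨x + 2 * c, 2 * d⟩ (11 : ℤ) * quartic y ⟨c, d⟩) := by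
  have hm : Odd (x + 2 * c) := hx.add_even (even_two_mul c)
  have hβ : IsPrimary ⟨x + 2 * c, 2 * d⟩ := ⟨hm, even_two_mul d⟩
  have hco : Odd c := Int.odd_iff.2 (by omega)
  have hπ : IsPrimary ⟨c, d⟩ := ⟨hco, hd⟩
  have hyo : Odd y := Int.odd_iff.2 (by omega)
  have hone : ∀ {n : ℤ}, Odd n → quartic 1 n = 1 := fun hn =>
    quartic_one_left (odd_norm_intCast hn)
  have key := quartic_descent (ρ := 1) (k := 0) (q := -11) (one_dvd 2) hβ hm hx (by norm_num)
    hyo (by linear_combination hxy) (one_mul _).symm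
    (fun r hr hro hrc hrd => hr.not_isUnit ?_)
    (fun r hr h hra => not_dvd_im_of_not_eleven_dvd h11 hr h hra)
  · rw [mul_zero, pow_zero, hone hyo, hone hx, hone hm, hone (by decide), Int.cast_neg,
      quartic_neg_right, quartic_χ₄_mul_χ₄ hβ.odd_norm hm hx, quartic_gaussI_intCast hm,
      quartic_two_mul_intCast hx, quartic_two_mul_intCast hyo, quartic_comm hπ hx,
      quartic_comm_of_emod_four_eq_one hπ hy, quartic_two hβ, gaussInt_norm_eq,
      gaussInt_norm_eq] at key
    rw [← iPow_congr (odd_exponent_modEq hc hd hx), ← iPow_mul_eq_iff]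
    simp only [iPow_add]
    linear_combination key
  · have hr2 : IsCoprime r 2 := Int.isCoprime_two_right.2 hro
    exact hcd.isUnit_of_dvd' (hr2.dvd_of_dvd_mul_left hrc) (hr2.dvd_of_dvd_mul_left hrd)

theorem χ₄_mul_self_ediv_four {n ν m : ℤ} (hν : ν = 1 ∨ ν = -1) (hn : n = ν * (4 * m + 1)) :
    ZMod.χ₄ n * n / 4 = m := by
  have h1 : ZMod.χ₄ (4 * m + 1 : ℤ) = 1 := ZMod.χ₄_int_one_mod_four (by omega)
  rcases hν with rfl | rfl
  · rw [hn, one_mul, h1]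
    omega
  · rw [hn, neg_one_mul, χ₄_neg_mul_neg, h1]
    omega

theorem sq_ediv_four {n ν m : ℤ} (hν : ν = 1 ∨ ν = -1) (hn : n = ν * (4 * m + 1)) :
    n ^ 2 / 4 = 4 * m ^ 2 + 2 * m := by
  have h : n ^ 2 = 4 * (4 * m ^ 2 + 2 * m) + 1 := by
    rcases hν with rfl | rfl <;> rw [hn] <;> ring
  omega

theorem quartic_one_sub_mul_gaussI_sq {ν m : ℤ} (hν : ν = 1 ∨ ν = -1) (hm : Odd m) :
    quartic ⟨1, -ν⟩ m ^ 2 = quartic gaussI m := by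
  have hsq : (⟨1, -ν⟩ : ℤ[i]) ^ 2 = (-2 * ν : ℤ) * gaussI := by
    rw [gaussI, pow_two]
    rcases hν with rfl | rfl <;> rfl
  have hm2 : IsCoprime (-2 * ν) m := by
    have h2 := Int.isCoprime_two_left.2 hm
    rcases hν with rfl | rfl
    · exact h2.neg_left
    · exact h2
  rw [← quartic_pow_left (odd_norm_intCast hm), hsq, quartic_intCast_mul hm hm2]

theorem quartic_rotate {n : ℤ} (hn : Odd n) (c d : ℤ) :
    quartic ⟨d, -c⟩ n = quartic gaussI n * quartic ⟨c, d⟩ n := by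
  rw [← quartic_mul_left, ← quartic_neg_left_intCast hn]
  congr 1
  rw [gaussI]
  ext <;> simp

theorem one_sub_mul_gaussI_dvd_two {ν : ℤ} (hν : ν = 1 ∨ ν = -1) : (⟨1, -ν⟩ : ℤ[i]) ∣ 2 :=
  ⟨⟨1, ν⟩, by rcases hν with rfl | rfl <;> rfl⟩

theorem one_sub_mul_gaussI_mul {ν : ℤ} (hν : ν = 1 ∨ ν = -1) (m b : ℤ) :
    (⟨ν * (4 * m + 1), -(4 * b + 1)⟩ : ℤ[i]) =
      ⟨1, -ν⟩ * ⟨ν * (2 * m + 2 * b + 1), 2 * (m - b)⟩ := by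
  ext <;> rcases hν with rfl | rfl <;> simp <;> ring

theorem isPrimary_cofactor {ν : ℤ} (hν : ν = 1 ∨ ν = -1) (m b : ℤ) :
    IsPrimary ⟨ν * (2 * m + 2 * b + 1), 2 * (m - b)⟩ := by
  have h : Odd (ν * (2 * m + 2 * b + 1)) := by
    rcases hν with rfl | rfl <;> rw [Int.odd_iff] <;> omega
  exact ⟨h, even_two_mul _⟩

theorem norm_cofactor_ediv_four {ν : ℤ} (hν : ν = 1 ∨ ν = -1) (m b : ℤ) :
    (⟨ν * (2 * m + 2 * b + 1), 2 * (m - b)⟩ : ℤ[i]).norm / 4 =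
      2 * m ^ 2 + m + 2 * b ^ 2 + b := by
  have h : (⟨ν * (2 * m + 2 * b + 1), 2 * (m - b)⟩ : ℤ[i]).norm =
      4 * (2 * m ^ 2 + m + 2 * b ^ 2 + b) + 1 := by
    rw [gaussInt_norm_eq]
    rcases hν with rfl | rfl <;> ring
  omega

theorem quartic_two_cofactor {ν : ℤ} (hν : ν = 1 ∨ ν = -1) (m b : ℤ) :
    quartic 2 ⟨ν * (2 * m + 2 * b + 1), 2 * (m - b)⟩ =
      iPow (ν * (2 * m + 2 * b + 1) * (m - b)) := by
  rw [quartic_two (isPrimary_cofactor hν m b), mul_left_comm,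
    Int.mul_ediv_cancel_left _ two_ne_zero]

theorem quartic_one_sub_mul_gaussI_neg_eleven {ν : ℤ} (hν : ν = 1 ∨ ν = -1) :
    quartic ⟨1, -ν⟩ (-11 : ℤ) = iPow (3 * ν) := by
  rw [quartic_one_sub_mul_gaussI hν (by decide), show ZMod.χ₄ (-11 : ℤ) = 1 from rfl]
  congr 1
  omega

theorem odd_of_eq_mul {n ν m : ℤ} (hν : ν = 1 ∨ ν = -1) (hn : n = ν * (4 * m + 1)) : Odd n := by
  rcases hν with rfl | rfl <;> rw [Int.odd_iff] <;> omega

-- Here `⟨x + d, -c⟩ = x - iπ` for `π = c + di`; the sign `ν` is the one for which the cofactor of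
-- `1 - νi` in it is primary.
theorem quartic_of_even {c d x y ν σ m u b : ℤ} {k : ℕ} (hν : ν = 1 ∨ ν = -1)
    (hσ : σ = 1 ∨ σ = -1) (hn : x + d = ν * (4 * m + 1)) (hx : x = σ * (4 * u + 1))
    (hc : c = 4 * b + 1) (hd : Even d) (hcd : IsCoprime c d) (hy : y % 4 = 1)
    (hnorm : c ^ 2 + d ^ 2 = x ^ 2 + 11 * (2 ^ k * y) ^ 2)
    (h11 : ¬ ((11 : ℤ) : ℤ[i]) ∣ ⟨x + d, -c⟩) :
    iPow ((x + d + x - 2) * (2 * m ^ 2 + m + 2 * b ^ 2 + b) + (4 * m ^ 2 + 2 * m) +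
        (4 * u ^ 2 + 2 * u) + (x - 1) * ((c ^ 2 + d ^ 2) / 4) +
        (1 - 2 * k) * (ν * (2 * m + 2 * b + 1) * (m - b)) + 3 * ν + ν * u + ν * m +
        c * d / 2 * k) * quartic x ⟨c, d⟩ =
      quartic ⟨x + d, -c⟩ (11 : ℤ) * quartic (2 ^ k * y : ℤ) ⟨c, d⟩ := by
  have hxo : Odd x := odd_of_eq_mul hσ hx
  have hno : Odd (x + d) := odd_of_eq_mul hν hn
  have hyo : Odd y := Int.odd_iff.2 (by omega)
  have hπ : IsPrimary ⟨c, d⟩ := ⟨Int.odd_iff.2 (show c % 2 = 1 by omega), hd⟩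
  have hβ := isPrimary_cofactor hν m b
  have hmul : (⟨x + d, -c⟩ : ℤ[i]) = ⟨1, -ν⟩ * ⟨ν * (2 * m + 2 * b + 1), 2 * (m - b)⟩ := by
    rw [hn, hc, one_sub_mul_gaussI_mul hν]
  have key := quartic_descent (k := k) (q := -11) (one_sub_mul_gaussI_dvd_two hν) hβ hno hxo
    (by norm_num) hyo (a := d) (b := -c) (by linear_combination hnorm) hmul
    (fun r hr _ hrd hrc => hr.not_isUnit (hcd.isUnit_of_dvd' ((dvd_neg (α := ℤ)).1 hrc) hrd))
    (fun r hr h hra => not_dvd_im_of_not_eleven_dvd h11 hr h hra)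
  rw [quartic_one_sub_mul_gaussI_sq hν hyo, quartic_χ₄_mul_χ₄ hβ.odd_norm hno hxo,
    norm_cofactor_ediv_four hν, quartic_two_cofactor hν, quartic_one_sub_mul_gaussI_neg_eleven hν,
    quartic_rotate hxo, quartic_rotate hyo, quartic_gaussI_intCast hno, quartic_gaussI_intCast hxo,
    quartic_gaussI_intCast hyo, quartic_one_sub_mul_gaussI hν hxo,
    quartic_one_sub_mul_gaussI hν hno, χ₄_mul_self_ediv_four hσ hx, χ₄_mul_self_ediv_four hν hn,
    sq_ediv_four hν hn, sq_ediv_four hσ hx, quartic_comm hπ hxo,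
    quartic_comm_of_emod_four_eq_one hπ hy, gaussInt_norm_eq, Int.cast_neg, quartic_neg_right,
    iPow_pow, Nat.cast_mul, Nat.cast_ofNat] at key
  rw [Int.cast_mul (2 ^ k), quartic_mul_left, Int.cast_pow, quartic_pow_left hπ.odd_norm,
    Int.cast_two, quartic_two hπ, iPow_pow]
  set T := ν * (2 * m + 2 * b + 1) * (m - b)
  set E := (x + d + x - 2) * (2 * m ^ 2 + m + 2 * b ^ 2 + b) + (4 * m ^ 2 + 2 * m) +
    (4 * u ^ 2 + 2 * u) + (x - 1) * ((c ^ 2 + d ^ 2) / 4) with hE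
  refine mul_left_cancel₀ (iPow_ne_zero (T * (2 * k) + y ^ 2 / 4 + -ν * u + -ν * m)) ?_
  rw [← mul_assoc, ← iPow_add, (by ring : T * (2 * k) + y ^ 2 / 4 + -ν * u + -ν * m +
    (E + (1 - 2 * k) * T + 3 * ν + ν * u + ν * m + c * d / 2 * k) =
      E + T + 3 * ν + y ^ 2 / 4 + c * d / 2 * k)]
  simp only [hE, iPow_add] at key ⊢
  linear_combination iPow (c * d / 2 * k) * key

theorem even_exponent_modEq_of_four_dvd {c d x y ν m u b : ℤ} (k : ℤ) (hν : ν = 1 ∨ ν = -1)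
    (hn : x + d = ν * (4 * m + 1)) (hx : x = ν * (4 * u + 1)) (hc : c = 4 * b + 1)
    (hd : 4 ∣ d) (hy : 4 ∣ y) (hnorm : c ^ 2 + d ^ 2 = x ^ 2 + 11 * y ^ 2) :
    -((x + d + x - 2) * (2 * m ^ 2 + m + 2 * b ^ 2 + b) + (4 * m ^ 2 + 2 * m) +
        (4 * u ^ 2 + 2 * u) + (x - 1) * ((c ^ 2 + d ^ 2) / 4) +
        (1 - 2 * k) * (ν * (2 * m + 2 * b + 1) * (m - b)) + 3 * ν + ν * u + ν * m +
        c * d / 2 * k) ≡ 1 + 2 * (x / 4 + y / 4) [ZMOD 4] := by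
  obtain ⟨δ, rfl⟩ := hd
  obtain ⟨η, rfl⟩ := hy
  obtain ⟨z, hz⟩ := (Int.even_mul_succ_self η).two_dvd
  have hT : (2 * m + 2 * b + 1) * (m - b) = δ * (ν * (4 * m + 1)) - 22 * η ^ 2 := by
    obtain rfl : x = ν * (4 * m + 1) - 4 * δ := by linarith
    rcases hν with rfl | rfl <;> rw [hc] at hnorm <;> linarith
  have hP : (c ^ 2 + (4 * δ) ^ 2) / 4 = 4 * b ^ 2 + 2 * b + 4 * δ ^ 2 := by
    rw [hc, (by ring : (4 * b + 1) ^ 2 + (4 * δ) ^ 2 = 4 * (4 * b ^ 2 + 2 * b + 4 * δ ^ 2) + 1)]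
    omega
  have hcd : c * (4 * δ) / 2 = 2 * δ * c := by
    rw [(by ring : c * (4 * δ) = 2 * (2 * δ * c)), Int.mul_ediv_cancel_left _ two_ne_zero]
  rw [hP, hcd, mul_assoc ν, hT, Int.mul_ediv_cancel_left _ four_ne_zero, hn, hc,
    Int.modEq_iff_dvd]
  rcases hν with rfl | rfl
  · obtain rfl : δ = m - u := by omega
    rw [hx, (by omega : 1 * (4 * u + 1) / 4 = u)]
    refine ⟨(m + u) * (2 * m ^ 2 + m + 2 * b ^ 2 + b) + m ^ 2 + u ^ 2 + 3 * u + 1 + z - 6 * η ^ 2 +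
      u * (4 * b ^ 2 + 2 * b + 4 * (m - u) ^ 2) + 11 * k * η ^ 2 +
      (m - u) * ((1 - 2 * k) * m + 2 * k * b + 1) - u, ?_⟩
    linear_combination 2 * hz
  · obtain rfl : δ = u - m := by omega
    rw [hx, (by omega : -1 * (4 * u + 1) / 4 = -u - 1)]
    refine ⟨-(m + u + 1) * (2 * m ^ 2 + m + 2 * b ^ 2 + b) + m ^ 2 + u ^ 2 - 1 + z + 5 * η ^ 2 -
      (2 * u + 1) * (2 * b ^ 2 + b + 2 * (u - m) ^ 2) - 11 * k * η ^ 2 +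
      (u - m) * ((1 - 2 * k) * m + 2 * k * b), ?_⟩
    linear_combination 2 * hz

theorem even_exponent_modEq_of_emod_four_eq_two {c d x y ν m w b : ℤ} (hν : ν = 1 ∨ ν = -1)
    (hn : x + d = ν * (4 * m + 1)) (hx : x = -ν * (4 * w + 1)) (hc : c = 4 * b + 1)
    (hd : d % 4 = 2) (hy : Odd y) (hnorm : c ^ 2 + d ^ 2 = x ^ 2 + 11 * (2 * y) ^ 2) :
    -((x + d + x - 2) * (2 * m ^ 2 + m + 2 * b ^ 2 + b) + (4 * m ^ 2 + 2 * m) +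
        (4 * w ^ 2 + 2 * w) + (x - 1) * ((c ^ 2 + d ^ 2) / 4) +
        (1 - 2) * (ν * (2 * m + 2 * b + 1) * (m - b)) + 3 * ν + ν * w + ν * m +
        c * d / 2) ≡ 1 + 2 * ((c ^ 2 + d ^ 2 - 5) / 8) [ZMOD 4] := by
  obtain ⟨δ, rfl⟩ : ∃ δ, d = 4 * δ + 2 := ⟨d / 4, by omega⟩
  obtain ⟨η, rfl⟩ := hy
  obtain ⟨z, hz⟩ := (Int.even_mul_succ_self η).two_dvd
  have hT : 2 * ((2 * m + 2 * b + 1) * (m - b)) =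
      ν * ((2 * δ + 1) * (4 * m + 1)) - 88 * z - 11 := by
    obtain rfl : x = ν * (4 * m + 1) - (4 * δ + 2) := by linarith
    rcases hν with rfl | rfl <;> rw [hc] at hnorm <;> linarith
  have hP : c ^ 2 + (4 * δ + 2) ^ 2 = 4 * (4 * b ^ 2 + 2 * b + (2 * δ + 1) ^ 2) + 1 := by
    rw [hc]
    ring
  have hcd : c * (4 * δ + 2) / 2 = (2 * δ + 1) * c := by
    rw [(by ring : c * (4 * δ + 2) = 2 * ((2 * δ + 1) * c)), Int.mul_ediv_cancel_left _ two_ne_zero]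
  rw [hP, (by omega : ∀ j : ℤ, (4 * j + 1) / 4 = j), hcd, hn, hc,
    (by ring : 4 * (4 * b ^ 2 + 2 * b + (2 * δ + 1) ^ 2) + 1 - 5 =
      8 * (2 * b ^ 2 + b + 2 * δ ^ 2 + 2 * δ)), Int.mul_ediv_cancel_left _ (by norm_num),
    Int.modEq_iff_dvd]
  rcases hν with rfl | rfl
  · obtain rfl : δ = m + w := by omega
    rw [hx]
    refine ⟨(m - w) * (2 * m ^ 2 + m + 2 * b ^ 2 + b) - 2 * b ^ 2 + w ^ 2 + 11 * z + w + 2 -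
      w * (4 * b ^ 2 + 2 * b + (2 * (m + w) + 1) ^ 2) + (m + w) * (2 * b - 2 * m - w - 1), ?_⟩
    linarith
  · obtain rfl : δ = -m - w - 1 := by omega
    rw [hx]
    refine ⟨(w - m) * (2 * m ^ 2 + m + 2 * b ^ 2 + b) + w ^ 2 - 11 * z + b + w - 1 +
      w * (4 * b ^ 2 + 2 * b + (2 * (m + w) + 1) ^ 2) + (m + w + 1) * (2 * m - 2 * b + w - 1), ?_⟩
    linarith

theorem exists_eq_mul_four_mul_add_one {n : ℤ} (hn : Odd n) :
    ∃ ν m : ℤ, (ν = 1 ∨ ν = -1) ∧ n = ν * (4 * m + 1) := by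
  rw [Int.odd_iff] at hn
  obtain h | h : n % 4 = 1 ∨ n % 4 = 3 := by omega
  · exact ⟨1, n / 4, .inl rfl, by omega⟩
  · exact ⟨-1, -(n / 4) - 1, .inr rfl, by omega⟩

theorem quartic_of_four_dvd {c d x y : ℤ} {k : ℕ} (hcd : IsCoprime c d) (hc : c % 4 = 1)
    (hd : 4 ∣ d) (hx : Odd x) (hy : y % 4 = 1) (hy4 : 4 ∣ 2 ^ k * y)
    (hnorm : c ^ 2 + d ^ 2 = x ^ 2 + 11 * (2 ^ k * y) ^ 2)
    (h11 : ¬ ((11 : ℤ) : ℤ[i]) ∣ ⟨x + d, -c⟩) :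
    quartic x ⟨c, d⟩ = iPow (1 + 2 * (x / 4 + 2 ^ k * y / 4)) *
      (quartic ⟨x + d, -c⟩ (11 : ℤ) * quartic (2 ^ k * y : ℤ) ⟨c, d⟩) := by
  obtain ⟨ν, u, hν, hx⟩ := exists_eq_mul_four_mul_add_one hx
  obtain ⟨m, hm⟩ : ∃ m, x + d = ν * (4 * m + 1) :=
    ⟨u + ν * (d / 4), by rcases hν with rfl | rfl <;> omega⟩
  obtain ⟨b, hb⟩ : ∃ b, c = 4 * b + 1 := ⟨c / 4, by omega⟩
  rw [← iPow_congr (even_exponent_modEq_of_four_dvd k hν hm hx hb hd hy4 hnorm), ← iPow_mul_eq_iff]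
  exact quartic_of_even hν hν hm hx hb (even_iff_two_dvd.2 (by omega)) hcd hy hnorm h11

theorem quartic_of_emod_four_eq_two {c d x y : ℤ} (hcd : IsCoprime c d) (hc : c % 4 = 1)
    (hd : d % 4 = 2) (hx : Odd x) (hy : y % 4 = 1)
    (hnorm : c ^ 2 + d ^ 2 = x ^ 2 + 11 * (2 * y) ^ 2)
    (h11 : ¬ ((11 : ℤ) : ℤ[i]) ∣ ⟨x + d, -c⟩) :
    quartic x ⟨c, d⟩ = iPow (1 + 2 * ((c ^ 2 + d ^ 2 - 5) / 8)) *
      (quartic ⟨x + d, -c⟩ (11 : ℤ) * quartic (2 * y : ℤ) ⟨c, d⟩) := by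
  obtain ⟨ν, m, hν, hm⟩ := exists_eq_mul_four_mul_add_one
    (hx.add_even (even_iff_two_dvd.2 (by omega : 2 ∣ d)))
  obtain ⟨w, hw⟩ : ∃ w, x = -ν * (4 * w + 1) :=
    ⟨-m + ν * ((d - 2) / 4) + (ν - 1) / 2, by rcases hν with rfl | rfl <;> omega⟩
  obtain ⟨b, hb⟩ : ∃ b, c = 4 * b + 1 := ⟨c / 4, by omega⟩
  rw [← iPow_congr (even_exponent_modEq_of_emod_four_eq_two hν hm hw hb hd
    (Int.odd_iff.2 (by omega)) hnorm), ← iPow_mul_eq_iff]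
  simpa using quartic_of_even (k := 1) hν (by omega) hm hw hb (even_iff_two_dvd.2 (by omega)) hcd
    hy (by simpa using hnorm) h11

theorem quartic_natPrime_eq_of_dvd {q : ℕ} [Fact q.Prime] (h4 : q % 4 = 3) {a z : ℤ[i]}
    (ha : ¬ (q : ℤ[i]) ∣ a) (hz : z ^ 4 = 1)
    (h : (q : ℤ[i]) ∣ star a ^ ((q + 1) / 4) - z * a ^ ((q + 1) / 4)) : quartic a q = z := by
  have hq : Prime (q : ℤ[i]) := GaussianInt.prime_of_nat_prime_of_mod_four_eq_three q h4
  have ho : Odd (q : ℤ[i]).norm := by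
    exact_mod_cast odd_norm_intCast (n := q) (Int.odd_iff.2 (by omega))
  have hfrob := (dvd_pow_sub_star h4 a).trans (sub_dvd_pow_sub_pow _ _ ((q + 1) / 4))
  have hsplit : (a ^ q) ^ ((q + 1) / 4) =
      a ^ ((q + 1) / 4) * a ^ ((q - 1) * ((q + 1) / 4)) := by
    rw [← pow_mul, ← pow_add, Nat.sub_mul, one_mul, Nat.add_sub_cancel']
    exact Nat.le_mul_of_pos_left _ (by omega)
  rw [quartic_prime hq]
  refine quarticPrime_eq hq ho (by rw [pow_succ, hz, one_mul]) ?_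
  rw [norm_natCast_natAbs_div_four h4]
  refine (hq.dvd_or_dvd (a := a ^ ((q + 1) / 4)) ?_).resolve_left (mt hq.dvd_of_dvd_pow ha)
  have hsum := dvd_add hfrob h
  rwa [sub_add_sub_cancel, hsplit, mul_comm z, ← mul_sub] at hsum

/-- The condition `x ≡ ±4a, ±9a (mod 11)`, with `ε` the sign. -/
def SignedResidue (ε a x : ℤ) : Prop :=
  x ≡ ε * (4 * a) [ZMOD 11] ∨ x ≡ ε * (9 * a) [ZMOD 11]

theorem mk_pow_three (a b : ℤ) :
    (⟨a, b⟩ : ℤ[i]) ^ 3 = ⟨a ^ 3 - 3 * a * b ^ 2, 3 * a ^ 2 * b - b ^ 3⟩ := by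
  rw [pow_three]
  ext <;> simp <;> ring

theorem zmod_eleven_cube_eq : ∀ ε a b x : ZMod 11, ε = 1 ∨ ε = -1 →
    x ^ 2 - 4 * (a ^ 2 + b ^ 2) = 0 → ¬ (x + 2 * a = 0 ∧ 2 * b = 0) →
    (x = ε * (4 * a) ∨ x = ε * (9 * a) →
      (1 + ε) * ((x + 2 * a) ^ 3 - 3 * (x + 2 * a) * (2 * b) ^ 2) = 0 ∧
      (1 - ε) * (3 * (x + 2 * a) ^ 2 * (2 * b) - (2 * b) ^ 3) = 0) ∧
    (x = ε * (4 * b) ∨ x = ε * (9 * b) →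
      (x + 2 * a) ^ 3 - 3 * (x + 2 * a) * (2 * b) ^ 2 =
        ε * (3 * (x + 2 * a) ^ 2 * (2 * b) - (2 * b) ^ 3)) := by
  decide

-- As `star z ≡ z ^ 11`, the quotient `star z ^ 3 / z ^ 3 ≡ z ^ 30` is the quartic symbol of `z`
-- modulo `11`.
theorem dvd_star_pow_three_sub {a b x ε : ℤ} (hε : ε = 1 ∨ ε = -1)
    (hx : 11 ∣ x ^ 2 - 4 * (a ^ 2 + b ^ 2)) (h11 : ¬ ((11 : ℤ) : ℤ[i]) ∣ ⟨x + 2 * a, 2 * b⟩)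
    {s : Fin 2} (hs : SignedResidue ε (![a, b] s) x) :
    ((11 : ℤ) : ℤ[i]) ∣ star ⟨x + 2 * a, 2 * b⟩ ^ 3 -
      (-ε : ℤ) * gaussI ^ (s : ℕ) * ⟨x + 2 * a, 2 * b⟩ ^ 3 := by
  have hcast (j : ℤ) : 11 ∣ j ↔ (j : ZMod 11) = 0 := (ZMod.intCast_zmod_eq_zero_iff_dvd j 11).symm
  have hε' : (ε : ZMod 11) = 1 ∨ (ε : ZMod 11) = -1 := by
    rcases hε with rfl | rfl <;> simp
  rw [Zsqrtd.intCast_dvd, hcast, hcast] at h11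
  rw [hcast] at hx
  push_cast at h11 hx
  have key := zmod_eleven_cube_eq ε a b x hε' hx h11
  have hs' : (x : ZMod 11) = ε * (4 * (![a, b] s : ℤ)) ∨
      (x : ZMod 11) = ε * (9 * (![a, b] s : ℤ)) := mod_cast
    hs.imp (ZMod.intCast_eq_intCast_iff _ _ 11).2 (ZMod.intCast_eq_intCast_iff _ _ 11).2
  rw [← star_pow, mk_pow_three, Zsqrtd.intCast_dvd, hcast, hcast]
  match s, hs' with
  | 0, hs' =>
    obtain ⟨hre, him⟩ := key.1 hs'
    constructor <;> simp only [gaussI, Zsqrtd.star_mk, neg_sub, Int.cast_neg,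
      Fin.isValue, Fin.coe_ofNat_eq_mod, Nat.zero_mod, pow_zero, mul_one, neg_mul, Zsqrtd.smul_val,
      sub_neg_eq_add, Zsqrtd.add_def, Int.cast_add, Int.cast_sub, Int.cast_pow, Int.cast_mul,
      Int.cast_ofNat]
    · linear_combination hre
    · linear_combination -him
  | 1, hs' =>
    have h := key.2 hs'
    have hsq : (ε : ZMod 11) ^ 2 = 1 := by rcases hε' with h | h <;> rw [h] <;> ring
    constructor <;> simp only [gaussI, Zsqrtd.star_mk, neg_sub, Int.cast_neg,
      Fin.isValue, Fin.coe_ofNat_eq_mod, Nat.mod_succ, pow_one, neg_mul, Zsqrtd.smul_val, mul_zero,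
      mul_one, sub_neg_eq_add, Zsqrtd.re_add, Zsqrtd.re_mul, Zsqrtd.im_add, Zsqrtd.im_mul, zero_mul,
      one_mul, zero_add, Int.cast_add, Int.cast_sub, Int.cast_pow, Int.cast_mul, Int.cast_ofNat]
    · linear_combination h
    · linear_combination ε * h + (3 * (x + 2 * a) ^ 2 * (2 * b) - (2 * b) ^ 3) * hsq

theorem quartic_eleven {a b x ε : ℤ} (hε : ε = 1 ∨ ε = -1)
    (hx : 11 ∣ x ^ 2 - 4 * (a ^ 2 + b ^ 2)) (h11 : ¬ ((11 : ℤ) : ℤ[i]) ∣ ⟨x + 2 * a, 2 * b⟩)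
    {s : Fin 2} (hs : SignedResidue ε (![a, b] s) x) :
    quartic ⟨x + 2 * a, 2 * b⟩ (11 : ℤ) = (-ε : ℤ) * gaussI ^ (s : ℕ) := by
  have : Fact (Nat.Prime 11) := ⟨by norm_num⟩
  have hz : ((-ε : ℤ) * gaussI ^ (s : ℕ)) ^ 4 = 1 := by
    rw [mul_pow, ← pow_mul, mul_comm _ 4, pow_mul, gaussI_pow_four, one_pow, mul_one]
    rcases hε with rfl | rfl <;> rfl
  exact mod_cast quartic_natPrime_eq_of_dvd (q := 11) (by norm_num) (mod_cast h11) hz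
    (mod_cast dvd_star_pow_three_sub hε hx h11 hs)

theorem SignedResidue.neg {ε a x : ℤ} (h : SignedResidue ε a x) : SignedResidue (-ε) a (-x) := by
  simpa only [SignedResidue, neg_mul] using h.imp Int.ModEq.neg Int.ModEq.neg

theorem SignedResidue.neg_neg {ε a x : ℤ} (h : SignedResidue ε a x) :
    SignedResidue (-ε) (-a) x := by
  simpa only [SignedResidue, mul_neg, neg_mul, _root_.neg_neg] using h

theorem eleven_not_dvd_or_neg {u v x : ℤ} (huv : ¬ (11 ∣ u ∧ 11 ∣ v)) :
    ¬ ((11 : ℤ) : ℤ[i]) ∣ ⟨x + u, v⟩ ∨ ¬ ((11 : ℤ) : ℤ[i]) ∣ ⟨-x + u, v⟩ := by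
  simp only [Zsqrtd.intCast_dvd]
  omega

theorem not_eleven_dvd_and_dvd {a b : ℤ} (h : IsCoprime a b) : ¬ (11 ∣ a ∧ 11 ∣ b) := fun hab =>
  int_prime_eleven.not_isUnit (h.isUnit_of_dvd' hab.1 hab.2)

theorem quartic_of_quartic_neg {a b z : ℤ[i]} (ha : Odd a.norm) {k k' : ℤ}
    (hk : k' ≡ k + 2 + a.norm / 2 [ZMOD 4]) (h : quartic (-b) a = iPow k' * z) :
    quartic b a = iPow k * -z := by
  have h4 := norm_emod_four_of_odd ha
  have hmod : a.norm / 2 + k' ≡ k + 2 [ZMOD 4] := by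
    have := hk.add_left (a.norm / 2)
    refine this.trans ?_
    rw [Int.modEq_iff_dvd]
    omega
  rw [← neg_neg b, neg_eq_neg_one_mul, quartic_mul_left, quartic_neg_one ha, h, ← mul_assoc,
    ← iPow_add, iPow_congr hmod, iPow_add, iPow_two]
  ring

theorem sq_add_mul_sq_modEq_eight {a b k : ℤ} (ha : Odd a) (hk : Odd k) (hb : Even b) :
    a ^ 2 + k * b ^ 2 ≡ 1 + 2 * b [ZMOD 8] := by
  obtain ⟨j, rfl⟩ := hk
  obtain ⟨m, rfl⟩ := even_iff_exists_two_mul.1 hb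
  obtain ⟨u, hu⟩ := Int.eight_dvd_sq_sub_one_of_odd ha
  obtain ⟨v, hv⟩ := Int.even_mul_pred_self m
  exact (Int.modEq_iff_dvd.2 ⟨u + v + j * m ^ 2, by linear_combination hu + 4 * hv⟩).symm

theorem quartic_of_odd_of_signedResidue {c d x y ε : ℤ} (hcd : IsCoprime c d) (hc : c % 4 = 1)
    (hd : Even d) (hxy : 4 * (c ^ 2 + d ^ 2) = x ^ 2 + 11 * y ^ 2) (hx : Odd x) (hy : y % 4 = 1)
    (hε : ε = 1 ∨ ε = -1) {s : Fin 2} (hs : SignedResidue ε (![c, d] s) x) :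
    quartic x ⟨c, d⟩ = iPow (2 * ((x ^ 2 - 1) / 8 + (x + 1) / 2 * ((c ^ 2 + d ^ 2) / 4 + 1))) *
      ((-ε : ℤ) * gaussI ^ (s : ℕ) * quartic y ⟨c, d⟩) := by
  have hco : Odd c := Int.odd_iff.2 (by omega)
  have ho : Odd (⟨c, d⟩ : ℤ[i]).norm := IsPrimary.odd_norm ⟨hco, hd⟩
  wlog h11 : ¬ ((11 : ℤ) : ℤ[i]) ∣ ⟨x + 2 * c, 2 * d⟩ generalizing x ε
  · -- `11` cannot divide both `x + 2π` and `-x + 2π`, and `-x` goes with the sign `-ε`.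
    have hdvd := not_eleven_dvd_and_dvd hcd
    have h11' := (eleven_not_dvd_or_neg (x := x) (by omega)).resolve_left h11
    have hneg := this (x := -x) (by rwa [neg_sq]) hx.neg (ε := -ε) (by omega) hs.neg h11'
    rw [Int.cast_neg, neg_sq] at hneg
    rw [quartic_of_quartic_neg ho (k := 2 * _) ?_ hneg]
    · rw [Int.cast_neg, Int.cast_neg]; ring
    have h4 := norm_emod_four_of_odd ho
    rw [gaussInt_norm_eq] at h4 ⊢
    dsimp only at h4 ⊢
    obtain ⟨m, hm⟩ : ∃ m, c ^ 2 + d ^ 2 = 4 * m + 1 := ⟨(c ^ 2 + d ^ 2) / 4, by omega⟩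
    obtain ⟨l, rfl⟩ := hx
    rw [hm, Int.modEq_iff_dvd, show (-(2 * l + 1) + 1) / 2 = -l by omega,
      show (2 * l + 1 + 1) / 2 = l + 1 by omega, show (4 * m + 1) / 4 = m by omega,
      show (4 * m + 1) / 2 = 2 * m by omega]
    exact ⟨l * (m + 1) + m + 1, by ring⟩
  have hdvd : 11 ∣ x ^ 2 - 4 * (c ^ 2 + d ^ 2) := ⟨-y ^ 2, by linear_combination -hxy⟩
  rw [quartic_of_odd hcd hc hd hxy hx hy h11, quartic_eleven hε hdvd h11 hs]

theorem gaussI_mul_quartic_eleven {c d x ε : ℤ} (hε : ε = 1 ∨ ε = -1)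
    (hx : 11 ∣ x ^ 2 - (c ^ 2 + d ^ 2)) (h11 : ¬ ((11 : ℤ) : ℤ[i]) ∣ ⟨x + d, -c⟩)
    {s : Fin 2} (hs : SignedResidue ε (![c, d] s) (2 * x)) :
    gaussI * quartic ⟨x + d, -c⟩ (11 : ℤ) = (-ε : ℤ) * gaussI ^ (s : ℕ) := by
  have hx' : 11 ∣ (2 * x) ^ 2 - 4 * (d ^ 2 + (-c) ^ 2) :=
    hx.elim fun j hj => ⟨4 * j, by linear_combination 4 * hj⟩
  have h11' : ¬ ((11 : ℤ) : ℤ[i]) ∣ ⟨2 * x + 2 * d, 2 * -c⟩ := by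
    simp only [Zsqrtd.intCast_dvd] at h11 ⊢
    omega
  rw [← quartic_two_mul_intCast (n := 11) (by decide), mul_add]
  match s, hs with
  | 0, hs =>
    rw [quartic_eleven (s := 1) (by omega) hx' h11' hs.neg_neg]
    simp only [Fin.val_one, Fin.val_zero, pow_zero, pow_one]
    push_cast
    linear_combination (ε : ℤ[i]) * gaussI_sq
  | 1, hs =>
    rw [quartic_eleven (s := 0) hε hx' h11' hs]
    simp only [Fin.val_one, Fin.val_zero, pow_zero, pow_one]
    ring

theorem quartic_of_signedResidue_two_mul {c d x y ε E E' : ℤ} (hcd : IsCoprime c d)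
    (ho : Odd (⟨c, d⟩ : ℤ[i]).norm) (hnorm : c ^ 2 + d ^ 2 = x ^ 2 + 11 * y ^ 2)
    (hε : ε = 1 ∨ ε = -1) {s : Fin 2} (hs : SignedResidue ε (![c, d] s) (2 * x))
    (hE : 2 * E' ≡ 2 * E + 2 + (⟨c, d⟩ : ℤ[i]).norm / 2 [ZMOD 4])
    (h : ¬ ((11 : ℤ) : ℤ[i]) ∣ ⟨x + d, -c⟩ → quartic x ⟨c, d⟩ =
      iPow (1 + 2 * E) * (quartic ⟨x + d, -c⟩ (11 : ℤ) * quartic y ⟨c, d⟩))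
    (h' : ¬ ((11 : ℤ) : ℤ[i]) ∣ ⟨-x + d, -c⟩ → quartic (-x : ℤ) ⟨c, d⟩ =
      iPow (1 + 2 * E') * (quartic ⟨-x + d, -c⟩ (11 : ℤ) * quartic y ⟨c, d⟩)) :
    quartic x ⟨c, d⟩ = iPow (2 * E) * ((-ε : ℤ) * gaussI ^ (s : ℕ) * quartic y ⟨c, d⟩) := by
  have hdvd : 11 ∣ x ^ 2 - (c ^ 2 + d ^ 2) := ⟨-y ^ 2, by linear_combination -hnorm⟩
  have hcd11 := not_eleven_dvd_and_dvd hcd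
  rcases eleven_not_dvd_or_neg (x := x) (u := d) (v := -c) (by omega) with h11 | h11
  · rw [h h11, add_comm 1, iPow_add, iPow_one, ← gaussI_mul_quartic_eleven hε hdvd h11 hs]
    ring
  · have hs' : SignedResidue (-ε) (![c, d] s) (2 * -x) := by simpa only [mul_neg] using hs.neg
    have hneg := h' h11
    rw [add_comm 1, iPow_add, iPow_one, mul_assoc, ← mul_assoc gaussI,
      gaussI_mul_quartic_eleven (by omega) (by rwa [neg_sq]) h11 hs', Int.cast_neg] at hneg
    rw [quartic_of_quartic_neg ho hE hneg, Int.cast_neg, Int.cast_neg]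
    ring

theorem quartic_of_four_dvd_of_signedResidue {c d x y ε : ℤ} {k : ℕ} (hcd : IsCoprime c d)
    (hc : c % 4 = 1) (hd : 4 ∣ d) (hx : Odd x) (hy : y % 4 = 1) (hy4 : 4 ∣ 2 ^ k * y)
    (hnorm : c ^ 2 + d ^ 2 = x ^ 2 + 11 * (2 ^ k * y) ^ 2) (hε : ε = 1 ∨ ε = -1) {s : Fin 2}
    (hs : SignedResidue ε (![c, d] s) (2 * x)) :
    quartic x ⟨c, d⟩ = iPow (2 * (x / 4 + 2 ^ k * y / 4)) *
      ((-ε : ℤ) * gaussI ^ (s : ℕ) * quartic (2 ^ k * y : ℤ) ⟨c, d⟩) := by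
  have hco : Odd c := Int.odd_iff.2 (by omega)
  have hd2 : Even d := even_iff_two_dvd.2 (by omega)
  refine quartic_of_signedResidue_two_mul (E' := -x / 4 + 2 ^ k * y / 4) hcd
    (IsPrimary.odd_norm ⟨hco, hd2⟩) hnorm hε hs ?_ (quartic_of_four_dvd hcd hc hd hx hy hy4 hnorm)
    (quartic_of_four_dvd hcd hc hd hx.neg hy hy4 (by rwa [neg_sq]))
  have hmod := sq_add_mul_sq_modEq_eight hco odd_one hd2
  rw [one_mul, Int.modEq_iff_dvd] at hmod
  rw [gaussInt_norm_eq, Int.modEq_iff_dvd]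
  have hx2 := Int.odd_iff.1 hx
  dsimp only
  omega

theorem quartic_of_emod_four_eq_two_of_signedResidue {c d x y ε : ℤ} (hcd : IsCoprime c d)
    (hc : c % 4 = 1) (hd : d % 4 = 2) (hx : Odd x) (hy : y % 4 = 1)
    (hnorm : c ^ 2 + d ^ 2 = x ^ 2 + 11 * (2 * y) ^ 2) (hε : ε = 1 ∨ ε = -1) {s : Fin 2}
    (hs : SignedResidue ε (![c, d] s) (2 * x)) :
    quartic x ⟨c, d⟩ = iPow (2 * ((c ^ 2 + d ^ 2 - 5) / 8)) *
      ((-ε : ℤ) * gaussI ^ (s : ℕ) * quartic (2 * y : ℤ) ⟨c, d⟩) := by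
  have hco : Odd c := Int.odd_iff.2 (by omega)
  have hd2 : Even d := even_iff_two_dvd.2 (by omega)
  refine quartic_of_signedResidue_two_mul (E' := (c ^ 2 + d ^ 2 - 5) / 8) hcd
    (IsPrimary.odd_norm ⟨hco, hd2⟩) hnorm hε hs ?_
    (quartic_of_emod_four_eq_two hcd hc hd hx hy hnorm)
    (quartic_of_emod_four_eq_two hcd hc hd hx.neg hy (by rwa [neg_sq]))
  have hmod := sq_add_mul_sq_modEq_eight hco odd_one hd2
  rw [one_mul, Int.modEq_iff_dvd] at hmod
  rw [gaussInt_norm_eq, Int.modEq_iff_dvd]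
  dsimp only
  omega

/-! ### Reduction modulo `p` -/

theorem map_iPow_two_mul {F : Type*} [Field F] (f : ℤ[i] →+* F) (k : ℤ) :
    f (iPow (2 * k)) = (-1) ^ k := by
  rcases Int.even_or_odd k with hk | hk
  · have h4 : 2 * k ≡ 0 [ZMOD 4] := Int.modEq_zero_iff_dvd.2 (mul_dvd_mul_left 2 hk.two_dvd)
    rw [hk.neg_one_zpow, iPow_congr h4, iPow_zero, map_one]
  · have h4 : 2 * k ≡ 2 * 1 [ZMOD 4] :=
      (show k ≡ 1 [ZMOD 2] from Int.odd_iff.1 hk).mul_left'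
    rw [hk.neg_one_zpow, iPow_congr h4, mul_one, iPow_two, map_neg, map_one]

theorem map_quartic_of_map_eq_zero {R : Type*} [CommRing R] {a : ℤ[i]} (ha : Prime a)
    (ho : Odd a.norm) {f : ℤ[i] →+* R} (hf : f a = 0) (b : ℤ[i]) :
    f (quartic b a) = f b ^ (a.norm.natAbs / 4) := by
  have hdvd := map_dvd f (quarticPrime_spec ha ho b).2
  rw [hf, zero_dvd_iff, map_sub, map_pow, sub_eq_zero] at hdvd
  rw [quartic_prime ha, hdvd]

theorem exists_ringHom_zmod {p : ℕ} [Fact p.Prime] {c d : ℤ} (hcd : (p : ℤ) = c ^ 2 + d ^ 2)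
    (hc : (c : ZMod p) ≠ 0) :
    ∃ f : ℤ[i] →+* ZMod p, f gaussI = d / c ∧ f ⟨c, d⟩ = 0 := by
  have hcd' : (c : ZMod p) ^ 2 + (d : ZMod p) ^ 2 = 0 := by
    have hcast := congrArg (Int.cast : ℤ → ZMod p) hcd
    push_cast at hcast
    rw [← hcast, ZMod.natCast_self]
  have hroot : (d / c : ZMod p) * (d / c) = ((-1 : ℤ) : ZMod p) := by
    push_cast
    field_simp
    linear_combination hcd'
  refine ⟨Zsqrtd.lift ⟨d / c, hroot⟩, ?_, ?_⟩
  · simp [gaussI]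
  · simp only [Zsqrtd.lift_apply_apply]
    field_simp
    rw [hcd', mul_zero]

theorem intCast_zmod_ne_zero {p : ℕ} [Fact p.Prime] {m k a b : ℤ}
    (h : m * (p : ℤ) = a ^ 2 + k * b ^ 2) (hm : ¬ (p : ℤ) ∣ m) (hk : ¬ (p : ℤ) ∣ k) :
    (a : ZMod p) ≠ 0 := by
  have hp : Prime (p : ℤ) := Nat.prime_iff_prime_int.1 Fact.out
  rw [Ne, ZMod.intCast_zmod_eq_zero_iff_dvd]
  rintro ⟨u, rfl⟩
  have hb : (p : ℤ) ∣ k * b ^ 2 := ⟨m - p * u ^ 2, by linear_combination -h⟩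
  obtain ⟨v, rfl⟩ := hp.dvd_of_dvd_pow ((hp.dvd_or_dvd hb).resolve_left hk)
  exact hm ⟨u ^ 2 + k * v ^ 2, mul_right_cancel₀ hp.ne_zero (by linear_combination h)⟩

theorem intCast_ne_zero_of_sq_add_sq {p : ℕ} [Fact p.Prime] {c d : ℤ}
    (hcd : (p : ℤ) = c ^ 2 + d ^ 2) : (c : ZMod p) ≠ 0 := by
  have hp1 : ¬ (p : ℤ) ∣ 1 := mod_cast (Fact.out : p.Prime).not_dvd_one
  exact intCast_zmod_ne_zero (by rw [one_mul, one_mul, hcd]) hp1 hp1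

theorem intCast_ne_zero_of_sq_add_eleven_mul_sq {p : ℕ} [Fact p.Prime] (hp4 : p % 4 = 1) {x y : ℤ}
    (hxy : 4 * (p : ℤ) = x ^ 2 + 11 * y ^ 2) : (x : ZMod p) ≠ 0 := by
  have hp : p.Prime := Fact.out
  refine intCast_zmod_ne_zero hxy (fun h => ?_) fun h => ?_
  · have h2 : p ∣ 2 ^ 2 := by exact_mod_cast h
    rw [(Nat.prime_dvd_prime_iff_eq hp Nat.prime_two).1 (hp.dvd_of_dvd_pow h2)] at hp4
    omega
  · rw [(Nat.prime_dvd_prime_iff_eq hp (q := 11) (by norm_num)).1 (by exact_mod_cast h)] at hp4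
    omega

theorem pow_eq_of_quartic_eq {p : ℕ} [Fact p.Prime] (hp2 : p ≠ 2) {c d x y ε E : ℤ} {n : ℕ}
    (hcd : (p : ℤ) = c ^ 2 + d ^ 2)
    (h : quartic x ⟨c, d⟩ = iPow (2 * E) * ((-ε : ℤ) * gaussI ^ n * quartic y ⟨c, d⟩)) :
    (x : ZMod p) ^ (p / 4) = (-1) ^ E * (-ε * (d / c) ^ n) * (y : ZMod p) ^ (p / 4) := by
  have hp : p.Prime := Fact.out
  obtain ⟨f, hI, hf⟩ := exists_ringHom_zmod hcd (intCast_ne_zero_of_sq_add_sq hcd)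
  have hn : (⟨c, d⟩ : ℤ[i]).norm = p := by rw [gaussInt_norm_eq, hcd]
  have ho : Odd (⟨c, d⟩ : ℤ[i]).norm := by
    rw [hn]
    exact_mod_cast hp.odd_of_ne_two hp2
  have hq (b : ℤ) : f (quartic b ⟨c, d⟩) = (b : ZMod p) ^ (p / 4) := by
    rw [map_quartic_of_map_eq_zero (prime_of_norm_prime hp hn) ho hf, hn, map_intCast,
      Int.natAbs_natCast]
  rw [← hq, h, map_mul, map_mul, map_mul, map_iPow_two_mul, hq, map_intCast, map_pow, hI]
  push_cast
  ring

section NegEleven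

variable {p : ℕ} [Fact p.Prime] {x y S : ZMod p}

theorem div_sq_eq_neg_eleven (hx : x ≠ 0) (h : x ^ 2 = -11 * y ^ 2) :
    y ≠ 0 ∧ (x / y) ^ 2 = -11 := by
  have hy : y ≠ 0 := by
    rintro rfl
    exact hx (pow_eq_zero_iff two_ne_zero |>.1 (by rw [h]; ring))
  exact ⟨hy, by rw [div_pow, h, mul_div_cancel_right₀ _ (pow_ne_zero 2 hy)]⟩

theorem neg_eleven_pow_of_emod_eight_eq_one (h8 : p % 8 = 1) (hx : x ≠ 0)
    (h : x ^ 2 = -11 * y ^ 2) (hS : x ^ (p / 4) = S * y ^ (p / 4)) : (-11) ^ (p / 8) = S := by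
  obtain ⟨hy, hsq⟩ := div_sq_eq_neg_eleven hx h
  rw [← hsq, ← pow_mul, show 2 * (p / 8) = p / 4 by omega, div_pow, hS,
    mul_div_cancel_right₀ _ (pow_ne_zero _ hy)]

theorem neg_eleven_pow_of_emod_eight_eq_five (h8 : p % 8 = 5) (hx : x ≠ 0)
    (h : x ^ 2 = -11 * y ^ 2) (hS : x ^ (p / 4) = S * y ^ (p / 4)) :
    (-11) ^ (p / 8) = S * (y / x) := by
  obtain ⟨hy, hsq⟩ := div_sq_eq_neg_eleven hx h
  have hS' : (x / y) ^ (2 * (p / 8) + 1) = S := by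
    rw [show 2 * (p / 8) + 1 = p / 4 by omega, div_pow, hS,
      mul_div_cancel_right₀ _ (pow_ne_zero _ hy)]
  rw [← hsq, ← pow_mul, ← hS', pow_succ, mul_assoc, div_mul_div_cancel₀ hy, div_self hx, mul_one]

end NegEleven

theorem isCoprime_of_prime_eq_sq_add_sq {p : ℕ} (hp : p.Prime) {c d : ℤ}
    (h : (p : ℤ) = c ^ 2 + d ^ 2) : IsCoprime c d := by
  have hpi := (Nat.prime_iff_prime_int.1 hp).irreducible
  rw [Int.isCoprime_iff_gcd_eq_one]
  have hsq : ((Int.gcd c d : ℤ)) * (Int.gcd c d : ℤ) ∣ (p : ℤ) := by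
    rw [h, ← pow_two]
    exact dvd_add (pow_dvd_pow_of_dvd (Int.gcd_dvd_left ..) 2)
      (pow_dvd_pow_of_dvd (Int.gcd_dvd_right ..) 2)
  exact Int.natAbs_of_isUnit (hpi.squarefree _ hsq)

theorem cast_sq_eq_neg_eleven_mul_sq {p : ℕ} {x y : ℤ} (hxy : 4 * (p : ℤ) = x ^ 2 + 11 * y ^ 2) :
    (x : ZMod p) ^ 2 = -11 * (y : ZMod p) ^ 2 := by
  have hcast := congrArg (Int.cast : ℤ → ZMod p) hxy
  push_cast at hcast
  rw [ZMod.natCast_self] at hcast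
  linear_combination -hcast

theorem even_of_odd_sq_add_sq {c d : ℤ} (hc : Odd c) (h : Odd (c ^ 2 + d ^ 2)) : Even d := by
  simpa [hc, parity_simps] using h

theorem emod_four_of_odd {n x y : ℤ} {t : ℕ} (hxy : 4 * n = x ^ 2 + 11 * (2 ^ t * y) ^ 2)
    (hx : Odd x) (hy : y % 4 = 1) : 2 ^ t * y % 4 = 1 := by
  have hodd : Odd (2 ^ t * y) := by
    by_contra hodd
    obtain ⟨z, hz⟩ := even_iff_exists_two_mul.1 (Int.not_odd_iff_even.1 hodd)
    have hx4 := Int.sq_mod_four_eq_one_of_odd hx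
    rw [hz, mul_pow] at hxy
    omega
  obtain rfl : t = 0 := by
    by_contra ht
    exact Int.not_even_iff_odd.2 hodd ((even_two.pow_of_ne_zero ht).mul_right y)
  rwa [pow_zero, one_mul]

theorem odd_exponent_modEq_of_emod_eight_eq_one {n x : ℤ} (hn : n % 8 = 1) (hx : Odd x) :
    2 * ((x ^ 2 - 1) / 8 + (x + 1) / 2 * (n / 4 + 1)) ≡ 2 * (1 + x / 4) [ZMOD 4] := by
  obtain ⟨m, rfl⟩ : ∃ m, n = 8 * m + 1 := ⟨n / 8, by omega⟩
  obtain ⟨l, rfl⟩ := hx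
  rcases Int.even_or_odd' l with ⟨j, rfl | rfl⟩
  · rw [show (2 * (2 * j) + 1) ^ 2 - 1 = 8 * (2 * j ^ 2 + j) by ring, Int.modEq_iff_dvd,
      show (2 * (2 * j) + 1 + 1) / 2 = 2 * j + 1 by omega,
      show (2 * (2 * j) + 1) / 4 = j by omega, show (8 * m + 1) / 4 = 2 * m by omega,
      Int.mul_ediv_cancel_left _ (by norm_num)]
    exact ⟨-(j ^ 2 + 2 * j * m + j + m), by ring⟩
  · rw [show (2 * (2 * j + 1) + 1) ^ 2 - 1 = 8 * (2 * j ^ 2 + 3 * j + 1) by ring,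
      Int.modEq_iff_dvd, show (2 * (2 * j + 1) + 1 + 1) / 2 = 2 * j + 2 by omega,
      show (2 * (2 * j + 1) + 1) / 4 = j by omega, show (8 * m + 1) / 4 = 2 * m by omega,
      Int.mul_ediv_cancel_left _ (by norm_num)]
    exact ⟨-(j ^ 2 + 2 * j * m + 2 * j + 2 * m + 1), by ring⟩

theorem odd_exponent_modEq_of_emod_eight_eq_five {n x : ℤ} (hn : n % 8 = 5) :
    2 * ((x ^ 2 - 1) / 8 + (x + 1) / 2 * (n / 4 + 1)) ≡ 2 * ((x ^ 2 - 1) / 8) [ZMOD 4] := by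
  rw [show n / 4 + 1 = 2 * (n / 8 + 1) by omega]
  exact (Int.modEq_iff_dvd.2 ⟨(x + 1) / 2 * (n / 8 + 1), by ring⟩).symm

theorem exists_odd_half {n x y : ℤ} (hn : n % 4 = 1) (hxy : 4 * n = x ^ 2 + 11 * y ^ 2)
    (hx : Even x) : ∃ X Y, x = 2 * X ∧ y = 2 * Y ∧ n = X ^ 2 + 11 * Y ^ 2 ∧ Odd X ∧ Even Y := by
  obtain ⟨X, rfl⟩ := even_iff_exists_two_mul.1 hx
  have hy : Even y := by
    by_contra hodd
    have := Int.sq_mod_four_eq_one_of_odd (Int.not_even_iff_odd.1 hodd)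
    rw [mul_pow] at hxy
    omega
  obtain ⟨Y, rfl⟩ := even_iff_exists_two_mul.1 hy
  have hn' : n = X ^ 2 + 11 * Y ^ 2 := by linarith [mul_pow 2 X 2, mul_pow 2 Y 2]
  have hX4 := sq_emod_four X
  have hY4 := sq_emod_four Y
  have hX : Odd (X ^ 2) := Int.odd_iff.2 (by omega)
  have hY : Even (Y ^ 2) := Int.even_iff.2 (by omega)
  exact ⟨X, Y, rfl, rfl, hn', (Int.odd_pow' two_ne_zero).1 hX, (Int.even_pow' two_ne_zero).1 hY⟩

theorem exists_two_pow_succ_mul {t : ℕ} {y Y : ℤ} (hy : y % 4 = 1) (h : 2 ^ t * y = 2 * Y) :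
    ∃ k : ℕ, Y = 2 ^ k * y := by
  cases t with
  | zero => omega
  | succ k => exact ⟨k, by rw [pow_succ'] at h; linarith⟩

theorem pow_two_mul_eq {R : Type*} [CommRing R] {X Y z : ℤ} {S : R} {n : ℕ} (hz : z = 2 * Y)
    (h : (X : R) ^ n = S * (Y : R) ^ n) : ((2 * X : ℤ) : R) ^ n = S * (z : R) ^ n := by
  rw [hz, Int.cast_mul, Int.cast_mul, mul_pow, mul_pow, h, mul_left_comm]

section

variable {p : ℕ} [Fact p.Prime] {c d x y ε : ℤ} {t : ℕ} {s : Fin 2}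

theorem isCoprime_and_even (hp2 : p ≠ 2) (hcd : (p : ℤ) = c ^ 2 + d ^ 2) (hc : c % 4 = 1) :
    IsCoprime c d ∧ Even d := by
  have hp : p.Prime := Fact.out
  have hco : Odd c := Int.odd_iff.2 (by omega)
  have hodd : Odd (p : ℤ) := mod_cast hp.odd_of_ne_two hp2
  exact ⟨isCoprime_of_prime_eq_sq_add_sq hp hcd, even_of_odd_sq_add_sq hco (hcd ▸ hodd)⟩

theorem neg_eleven_pow_of_odd_of_emod_eight_eq_one (h8 : p % 8 = 1)
    (hcd : (p : ℤ) = c ^ 2 + d ^ 2) (hxy : 4 * (p : ℤ) = x ^ 2 + 11 * (2 ^ t * y) ^ 2)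
    (hc : c % 4 = 1) (hx : Odd x) (hy : y % 4 = 1) (hε : ε = 1 ∨ ε = -1)
    (hs : SignedResidue ε (![c, d] s) x) :
    (-11 : ZMod p) ^ (p / 8) = ε * (-1) ^ (x / 4) * (d / c) ^ (s : ℕ) := by
  obtain ⟨hcop, hd⟩ := isCoprime_and_even (by omega) hcd hc
  have hq := quartic_of_odd_of_signedResidue hcop hc hd (by rw [← hcd, hxy]) hx
    (emod_four_of_odd hxy hx hy) hε hs
  rw [← hcd, iPow_congr (odd_exponent_modEq_of_emod_eight_eq_one (by omega) hx)] at hq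
  rw [neg_eleven_pow_of_emod_eight_eq_one h8
    (intCast_ne_zero_of_sq_add_eleven_mul_sq (by omega) hxy)
    (cast_sq_eq_neg_eleven_mul_sq hxy) (pow_eq_of_quartic_eq (by omega) hcd hq),
    zpow_add₀ (neg_ne_zero.2 one_ne_zero)]
  ring

theorem neg_eleven_pow_of_odd_of_emod_eight_eq_five (h8 : p % 8 = 5)
    (hcd : (p : ℤ) = c ^ 2 + d ^ 2) (hxy : 4 * (p : ℤ) = x ^ 2 + 11 * (2 ^ t * y) ^ 2)
    (hc : c % 4 = 1) (hx : Odd x) (hy : y % 4 = 1) (hε : ε = 1 ∨ ε = -1)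
    (hs : SignedResidue ε (![c, d] s) x) :
    (-11 : ZMod p) ^ (p / 8) =
      -ε * (-1) ^ ((x ^ 2 - 1) / 8) * ((d / c) ^ (s : ℕ) * ((2 ^ t * y : ℤ) / x)) := by
  obtain ⟨hcop, hd⟩ := isCoprime_and_even (by omega) hcd hc
  have hq := quartic_of_odd_of_signedResidue hcop hc hd (by rw [← hcd, hxy]) hx
    (emod_four_of_odd hxy hx hy) hε hs
  rw [← hcd, iPow_congr (odd_exponent_modEq_of_emod_eight_eq_five (by omega))] at hq
  rw [neg_eleven_pow_of_emod_eight_eq_five h8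
    (intCast_ne_zero_of_sq_add_eleven_mul_sq (by omega) hxy)
    (cast_sq_eq_neg_eleven_mul_sq hxy) (pow_eq_of_quartic_eq (by omega) hcd hq)]
  ring

theorem four_dvd_of_emod_eight_eq_one {n a b k : ℤ} (hn : n % 8 = 1) (h : n = a ^ 2 + k * b ^ 2)
    (ha : Odd a) (hk : Odd k) (hb : Even b) : 4 ∣ b := by
  have hmod := h ▸ sq_add_mul_sq_modEq_eight ha hk hb
  rw [Int.modEq_iff_dvd] at hmod
  omega

theorem emod_four_eq_two_of_emod_eight_eq_five {n a b k : ℤ} (hn : n % 8 = 5)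
    (h : n = a ^ 2 + k * b ^ 2) (ha : Odd a) (hk : Odd k) (hb : Even b) : b % 4 = 2 := by
  have hmod := h ▸ sq_add_mul_sq_modEq_eight ha hk hb
  rw [Int.modEq_iff_dvd] at hmod
  omega

theorem eight_dvd_of_emod_eight_eq_one {n x y : ℤ} (hn : n % 8 = 1)
    (hxy : 4 * n = x ^ 2 + 11 * y ^ 2) (hx : Even x) : 8 ∣ y := by
  obtain ⟨X, Y, -, rfl, hXY, hX, hY⟩ := exists_odd_half (by omega) hxy hx
  exact mul_dvd_mul_left 2 (four_dvd_of_emod_eight_eq_one hn hXY hX (by decide) hY)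

theorem eq_two_mul_of_emod_four_eq_two {t : ℕ} {y Y : ℤ} (hy : y % 4 = 1) (hY : Y % 4 = 2)
    (h : 2 ^ t * y = 2 * Y) : Y = 2 * y := by
  obtain ⟨k, rfl⟩ := exists_two_pow_succ_mul hy h
  match k with
  | 0 => omega
  | 1 => rfl
  | k + 2 =>
    rw [pow_add, mul_comm _ (2 ^ 2), mul_assoc] at hY
    omega

theorem neg_eleven_pow_of_even_of_emod_eight_eq_one (h8 : p % 8 = 1)
    (hcd : (p : ℤ) = c ^ 2 + d ^ 2) (hxy : 4 * (p : ℤ) = x ^ 2 + 11 * (2 ^ t * y) ^ 2)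
    (hc : c % 4 = 1) (hx : Even x) (hy : y % 4 = 1) (hε : ε = 1 ∨ ε = -1)
    (hs : SignedResidue ε (![c, d] s) x) :
    (-11 : ZMod p) ^ (p / 8) = -ε * (-1) ^ (x / 8 + 2 ^ t * y / 8) * (d / c) ^ (s : ℕ) := by
  obtain ⟨hcop, hd⟩ := isCoprime_and_even (by omega) hcd hc
  have hco : Odd c := Int.odd_iff.2 (by omega)
  have hx0 := intCast_ne_zero_of_sq_add_eleven_mul_sq (by omega) hxy
  have hsq := cast_sq_eq_neg_eleven_mul_sq hxy
  obtain ⟨X, Y, rfl, hY, hXY, hX, hYe⟩ := exists_odd_half (by omega) hxy hx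
  have hY4 : 4 ∣ Y := four_dvd_of_emod_eight_eq_one (by omega) hXY hX (by decide) hYe
  have hd4 : 4 ∣ d := four_dvd_of_emod_eight_eq_one (n := p) (k := 1) (by omega)
    (by rw [hcd, one_mul]) hco odd_one hd
  obtain ⟨k, rfl⟩ := exists_two_pow_succ_mul hy hY
  have hpow := pow_eq_of_quartic_eq (by omega) hcd
    (quartic_of_four_dvd_of_signedResidue hcop hc hd4 hX hy hY4 (hcd ▸ hXY) hε hs)
  rw [neg_eleven_pow_of_emod_eight_eq_one h8 hx0 hsq (pow_two_mul_eq hY hpow),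
    show 2 * X / 8 + 2 ^ t * y / 8 = X / 4 + 2 ^ k * y / 4 by omega]
  ring

theorem neg_eleven_pow_of_even_of_emod_eight_eq_five (h8 : p % 8 = 5)
    (hcd : (p : ℤ) = c ^ 2 + d ^ 2) (hxy : 4 * (p : ℤ) = x ^ 2 + 11 * (2 ^ t * y) ^ 2)
    (hc : c % 4 = 1) (hx : Even x) (hy : y % 4 = 1) (hε : ε = 1 ∨ ε = -1)
    (hs : SignedResidue ε (![c, d] s) x) :
    (-11 : ZMod p) ^ (p / 8) =
      -ε * (-1) ^ ((p - 5) / 8) * ((d / c) ^ (s : ℕ) * ((2 ^ t * y : ℤ) / x)) := by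
  obtain ⟨hcop, hd⟩ := isCoprime_and_even (by omega) hcd hc
  have hco : Odd c := Int.odd_iff.2 (by omega)
  have hx0 := intCast_ne_zero_of_sq_add_eleven_mul_sq (by omega) hxy
  have hsq := cast_sq_eq_neg_eleven_mul_sq hxy
  obtain ⟨X, Y, rfl, hY, hXY, hX, hYe⟩ := exists_odd_half (by omega) hxy hx
  have hY4 := emod_four_eq_two_of_emod_eight_eq_five (by omega) hXY hX (by decide) hYe
  have hd4 : d % 4 = 2 := emod_four_eq_two_of_emod_eight_eq_five (n := p) (k := 1) (by omega)
    (by rw [hcd, one_mul]) hco odd_one hd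
  obtain rfl := eq_two_mul_of_emod_four_eq_two hy hY4 hY
  have hpow := pow_eq_of_quartic_eq (by omega) hcd
    (quartic_of_emod_four_eq_two_of_signedResidue hcop hc hd4 hX hy (hcd ▸ hXY) hε hs)
  rw [neg_eleven_pow_of_emod_eight_eq_five h8 hx0 hsq (pow_two_mul_eq hY hpow), ← hcd,
    show ((p : ℤ) - 5) / 8 = ((p - 5) / 8 : ℕ) by omega, zpow_natCast]
  ring

end

theorem exists_signedResidue {c d x : ℤ} (h : x ^ 2 ≡ 4 * (c ^ 2 + d ^ 2) [ZMOD 11]) :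
    ∃ ε : ℤ, (ε = 1 ∨ ε = -1) ∧ (SignedResidue ε c x ∨ SignedResidue ε d x) := by
  have key : ∀ c d x : ZMod 11, x ^ 2 = 4 * (c ^ 2 + d ^ 2) → ∃ ε : ZMod 11, (ε = 1 ∨ ε = -1) ∧
      ((x = ε * (4 * c) ∨ x = ε * (9 * c)) ∨ x = ε * (4 * d) ∨ x = ε * (9 * d)) := by decide +kernel
  have hcast (a b : ℤ) : a ≡ b [ZMOD 11] ↔ (a : ZMod 11) = b :=
    (ZMod.intCast_eq_intCast_iff a b 11).symm
  simp only [SignedResidue, hcast] at h ⊢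
  obtain ⟨ε, rfl | rfl, hε⟩ := key c d x (mod_cast h)
  · exact ⟨1, .inl rfl, mod_cast hε⟩
  · exact ⟨-1, .inr rfl, mod_cast hε⟩

theorem theorem3p5_general (p : ℕ) [Fact p.Prime] (hp4 : p % 4 = 1) (c d x y y₀ : ℤ) (t : ℕ)
    (hcd : (p : ℤ) = c ^ 2 + d ^ 2) (hxy : 4 * (p : ℤ) = x ^ 2 + 11 * y ^ 2)
    (hc : c ≡ 1 [ZMOD 4]) (hy : y = 2 ^ t * y₀) (hy₀ : y₀ ≡ 1 [ZMOD 4]) :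
    ((c : ZMod p) ≠ 0 ∧ (x : ZMod p) ≠ 0) ∧
    (∃ ε : ℤ, (ε = 1 ∨ ε = -1) ∧
      ((x ≡ ε * (4 * c) [ZMOD 11] ∨ x ≡ ε * (9 * c) [ZMOD 11]) ∨
        (x ≡ ε * (4 * d) [ZMOD 11] ∨ x ≡ ε * (9 * d) [ZMOD 11]))) ∧
    (p % 8 = 1 → ¬ 2 ∣ x → ∀ ε : ℤ, ε = 1 ∨ ε = -1 →
      ((x ≡ ε * (4 * c) [ZMOD 11] ∨ x ≡ ε * (9 * c) [ZMOD 11]) →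
        (-11 : ZMod p) ^ (p / 8) = (ε : ZMod p) * (-1 : ZMod p) ^ (x / 4)) ∧
      ((x ≡ ε * (4 * d) [ZMOD 11] ∨ x ≡ ε * (9 * d) [ZMOD 11]) →
        (-11 : ZMod p) ^ (p / 8) =
          (ε : ZMod p) * (-1 : ZMod p) ^ (x / 4) * ((d : ZMod p) / (c : ZMod p)))) ∧
    (p % 8 = 1 → 2 ∣ x → 8 ∣ y ∧ ∀ ε : ℤ, ε = 1 ∨ ε = -1 →
      ((x ≡ ε * (4 * c) [ZMOD 11] ∨ x ≡ ε * (9 * c) [ZMOD 11]) →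
        (-11 : ZMod p) ^ (p / 8) = -(ε : ZMod p) * (-1 : ZMod p) ^ (x / 8 + y / 8)) ∧
      ((x ≡ ε * (4 * d) [ZMOD 11] ∨ x ≡ ε * (9 * d) [ZMOD 11]) →
        (-11 : ZMod p) ^ (p / 8) =
          -(ε : ZMod p) * (-1 : ZMod p) ^ (x / 8 + y / 8) * ((d : ZMod p) / (c : ZMod p)))) ∧
    (p % 8 = 5 → ¬ 2 ∣ x → ∀ ε : ℤ, ε = 1 ∨ ε = -1 →
      ((x ≡ ε * (4 * c) [ZMOD 11] ∨ x ≡ ε * (9 * c) [ZMOD 11]) →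
        (-11 : ZMod p) ^ (p / 8) =
          -(ε : ZMod p) * (-1 : ZMod p) ^ ((x ^ 2 - 1) / 8) * ((y : ZMod p) / (x : ZMod p))) ∧
      ((x ≡ ε * (4 * d) [ZMOD 11] ∨ x ≡ ε * (9 * d) [ZMOD 11]) →
        (-11 : ZMod p) ^ (p / 8) =
          -(ε : ZMod p) * (-1 : ZMod p) ^ ((x ^ 2 - 1) / 8) *
            (((d : ZMod p) * (y : ZMod p)) / ((c : ZMod p) * (x : ZMod p))))) ∧
    (p % 8 = 5 → 2 ∣ x → ∀ ε : ℤ, ε = 1 ∨ ε = -1 →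
      ((x ≡ ε * (4 * c) [ZMOD 11] ∨ x ≡ ε * (9 * c) [ZMOD 11]) →
        (-11 : ZMod p) ^ (p / 8) =
          -(ε : ZMod p) * (-1 : ZMod p) ^ ((p - 5) / 8) * ((y : ZMod p) / (x : ZMod p))) ∧
      ((x ≡ ε * (4 * d) [ZMOD 11] ∨ x ≡ ε * (9 * d) [ZMOD 11]) →
        (-11 : ZMod p) ^ (p / 8) =
          -(ε : ZMod p) * (-1 : ZMod p) ^ ((p - 5) / 8) *
            (((d : ZMod p) * (y : ZMod p)) / ((c : ZMod p) * (x : ZMod p))))) := by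
  subst hy
  have h11 : x ^ 2 ≡ 4 * (c ^ 2 + d ^ 2) [ZMOD 11] :=
    Int.modEq_iff_dvd.2 ⟨(2 ^ t * y₀) ^ 2, by linear_combination hxy - 4 * hcd⟩
  have hodd : ¬ 2 ∣ x → Odd x := fun h => Int.not_even_iff_odd.1 (mt Even.two_dvd h)
  have heven : 2 ∣ x → Even x := even_iff_two_dvd.2
  simp only [← div_mul_div_comm]
  refine ⟨⟨intCast_ne_zero_of_sq_add_sq hcd, intCast_ne_zero_of_sq_add_eleven_mul_sq hp4 hxy⟩,
    exists_signedResidue h11, fun h8 hx ε hε => ?_,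
    fun h8 hx => ⟨eight_dvd_of_emod_eight_eq_one (by omega) hxy (heven hx), fun ε hε => ?_⟩,
    fun h8 hx ε hε => ?_, fun h8 hx ε hε => ?_⟩
  · have key (s : Fin 2) :=
      neg_eleven_pow_of_odd_of_emod_eight_eq_one (s := s) h8 hcd hxy hc (hodd hx) hy₀ hε
    exact ⟨fun h => by simpa using key 0 h, fun h => by simpa using key 1 h⟩
  · have key (s : Fin 2) :=
      neg_eleven_pow_of_even_of_emod_eight_eq_one (s := s) h8 hcd hxy hc (heven hx) hy₀ hε
    exact ⟨fun h => by simpa using key 0 h, fun h => by simpa using key 1 h⟩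
  · have key (s : Fin 2) :=
      neg_eleven_pow_of_odd_of_emod_eight_eq_five (s := s) h8 hcd hxy hc (hodd hx) hy₀ hε
    exact ⟨fun h => by simpa using key 0 h, fun h => by simpa using key 1 h⟩
  · have key (s : Fin 2) :=
      neg_eleven_pow_of_even_of_emod_eight_eq_five (s := s) h8 hcd hxy hc (heven hx) hy₀ hε
    exact ⟨fun h => by simpa using key 0 h, fun h => by simpa using key 1 h⟩

/-- Integer division `x / 4`, `x / 8` is the floor (the divisor is positive); `y / 8`,
`(x ^ 2 - 1) / 8` and `(p - 5) / 8` are exact where they are used. Fractions such as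
`d / c` and `y / x` are taken in the field `ZMod p`; the denominators are nonzero there by the
first conjunct. The integer `ε` is the sign `±` of the case: `ε = 1` for the upper signs and
`ε = -1` for the lower signs. The second conjunct says that the cases are exhaustive. -/
theorem theorem3p5 (p : ℕ) [Fact p.Prime] (hp4 : p % 4 = 1) (hleg : legendreSym p (-11) = 1)
    (c d x y d₀ y₀ : ℤ) (r t : ℕ)
    (hcd : (p : ℤ) = c ^ 2 + d ^ 2) (hxy : 4 * (p : ℤ) = x ^ 2 + 11 * y ^ 2)
    (hc : c ≡ 1 [ZMOD 4])
    (hd : d = 2 ^ r * d₀) (hd₀ : ¬ 2 ∣ d₀)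
    (hy : y = 2 ^ t * y₀) (hy₀ : y₀ ≡ 1 [ZMOD 4])
    (hgcd : Int.gcd c (x + 2 * d) = 1 ∨ Int.gcd d₀ (x + 2 * c) = 1) :
    ((c : ZMod p) ≠ 0 ∧ (x : ZMod p) ≠ 0) ∧
    (∃ ε : ℤ, (ε = 1 ∨ ε = -1) ∧
      ((x ≡ ε * (4 * c) [ZMOD 11] ∨ x ≡ ε * (9 * c) [ZMOD 11]) ∨
        (x ≡ ε * (4 * d) [ZMOD 11] ∨ x ≡ ε * (9 * d) [ZMOD 11]))) ∧
    (p % 8 = 1 → ¬ 2 ∣ x → ∀ ε : ℤ, ε = 1 ∨ ε = -1 →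
      ((x ≡ ε * (4 * c) [ZMOD 11] ∨ x ≡ ε * (9 * c) [ZMOD 11]) →
        (-11 : ZMod p) ^ (p / 8) = (ε : ZMod p) * (-1 : ZMod p) ^ (x / 4)) ∧
      ((x ≡ ε * (4 * d) [ZMOD 11] ∨ x ≡ ε * (9 * d) [ZMOD 11]) →
        (-11 : ZMod p) ^ (p / 8) =
          (ε : ZMod p) * (-1 : ZMod p) ^ (x / 4) * ((d : ZMod p) / (c : ZMod p)))) ∧
    (p % 8 = 1 → 2 ∣ x → 8 ∣ y ∧ ∀ ε : ℤ, ε = 1 ∨ ε = -1 →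
      ((x ≡ ε * (4 * c) [ZMOD 11] ∨ x ≡ ε * (9 * c) [ZMOD 11]) →
        (-11 : ZMod p) ^ (p / 8) = -(ε : ZMod p) * (-1 : ZMod p) ^ (x / 8 + y / 8)) ∧
      ((x ≡ ε * (4 * d) [ZMOD 11] ∨ x ≡ ε * (9 * d) [ZMOD 11]) →
        (-11 : ZMod p) ^ (p / 8) =
          -(ε : ZMod p) * (-1 : ZMod p) ^ (x / 8 + y / 8) * ((d : ZMod p) / (c : ZMod p)))) ∧
    (p % 8 = 5 → ¬ 2 ∣ x → ∀ ε : ℤ, ε = 1 ∨ ε = -1 →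
      ((x ≡ ε * (4 * c) [ZMOD 11] ∨ x ≡ ε * (9 * c) [ZMOD 11]) →
        (-11 : ZMod p) ^ (p / 8) =
          -(ε : ZMod p) * (-1 : ZMod p) ^ ((x ^ 2 - 1) / 8) * ((y : ZMod p) / (x : ZMod p))) ∧
      ((x ≡ ε * (4 * d) [ZMOD 11] ∨ x ≡ ε * (9 * d) [ZMOD 11]) →
        (-11 : ZMod p) ^ (p / 8) =
          -(ε : ZMod p) * (-1 : ZMod p) ^ ((x ^ 2 - 1) / 8) *
            (((d : ZMod p) * (y : ZMod p)) / ((c : ZMod p) * (x : ZMod p))))) ∧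
    (p % 8 = 5 → 2 ∣ x → ∀ ε : ℤ, ε = 1 ∨ ε = -1 →
      ((x ≡ ε * (4 * c) [ZMOD 11] ∨ x ≡ ε * (9 * c) [ZMOD 11]) →
        (-11 : ZMod p) ^ (p / 8) =
          -(ε : ZMod p) * (-1 : ZMod p) ^ ((p - 5) / 8) * ((y : ZMod p) / (x : ZMod p))) ∧
      ((x ≡ ε * (4 * d) [ZMOD 11] ∨ x ≡ ε * (9 * d) [ZMOD 11]) →
        (-11 : ZMod p) ^ (p / 8) =
          -(ε : ZMod p) * (-1 : ZMod p) ^ ((p - 5) / 8) *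
            (((d : ZMod p) * (y : ZMod p)) / ((c : ZMod p) * (x : ZMod p))))) :=
  theorem3p5_general p hp4 c d x y y₀ t hcd hxy hc hy hy₀
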